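/- **Proposition 3.3.** Let $N\ge 2$, $p>1$, $s_1,s_p\in(0,1)$, and let $\Omega\subset\mathbb R^N$ be a bounded domain. For $S\subset\mathbb R^N$, $\gamma\in(0,1)$, $q\ge1$, let $W^{\gamma,q}(S)$ be the set of $w\in L^q(S)$ with $\int_S\int_S\frac{|w(x)-w(y)|^q}{|x-y|^{N+\gamma q}}\,dx\,dy<\infty$, and let $W^{\gamma,q}_{\rm loc}(\Omega)$ be the set of functions belonging to $W^{\gamma,q}(U)$ for every open $U\subset\subset\Omega$. Let $L^{p-1}_{s_pp}(\mathbb R^N)$ be the set of $w\in L^{p-1}_{\rm loc}(\mathbb R^N)$ with $\int_{\mathbb R^N}\frac{|w(x)|^{p-1}}{(1+|x|)^{N+s_pp}}\,dx<\infty$. For such $w$ put $$\mathrm{Tail}(w;x_0,R)=\Big(R^{s_pp}\int_{\mathbb R^N\setminus B_R(x_0)}\frac{|w(x)|^{p-1}}{|x-x_0|^{N+s_pp}}\,dx\Big)^{\frac1{p-1}}.$$ A function $u\in W^{s_1,1}_{\rm loc}(\Omega)\cap W^{s_p,p}_{\rm loc}(\Omega)\cap L^{p-1}_{s_pp}(\mathbb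 R^N)$ is a weak solution of $(-\Delta_1)^{s_1}u+(-\Delta_p)^{s_p}u=0$ in $\Omega$ if there is $Z\in L^\infty(\mathbb R^N\times\mathbb R^N)$ with $Z(x,y)\in\mathrm{sgn}(u(x)-u(y))$ for a.e. $(x,y)$, where $\mathrm{sgn}(t)=\{t/|t|\}$ for $t\ne0$ and $\mathrm{sgn}(0)=[-1,1]$, such that $$\int_{\mathbb R^N}\!\int_{\mathbb R^N}Z(x,y)\frac{\varphi(x)-\varphi(y)}{|x-y|^{N+s_1}}\,dx\,dy+\int_{\mathbb R^N}\!\int_{\mathbb R^N}\frac{|u(x)-u(y)|^{p-2}(u(x)-u(y))(\varphi(x)-\varphi(y))}{|x-y|^{N+s_pp}}\,dx\,dy=0$$ for every $\varphi\in W^{s_1,1}(\mathbb R^N)\cap W^{s_p,p}(\mathbb R^N)$ with compact support in $\Omega$. For $r>0$ and $t\ge0$ let $$H_r(t)=\frac{t}{r^{s_1}}+\frac{t^p}{r^{s_pp}},\qquad h_r(t)=\frac1{r^{s_1}}+\frac{t^{p-1}}{r^{s_pp}},$$ and let $H_r^{-1},h_r^{-1}$ be their inverses, with $h_r^{-1}(y)=0$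 for $y<h_r(0)=r^{-s_1}$. Write $u_+=\max\{u,0\}$ and $u_-=\max\{-u,0\}$. Then every weak solution $u$ is locally bounded in $\Omega$, that is, essentially bounded on every compact subset of $\Omega$. Moreover, for every $\delta>0$ there is a constant $C_\delta>0$, depending only on $N,p,s_1,s_p$ and $\delta$, such that for every such $\Omega$, every weak solution $u$ in $\Omega$, and every ball with $r>0$ and $B_{2r}(x_0)\subset\subset\Omega$, $$\operatorname*{ess\,sup}_{B_{r/2}(x_0)}u_\pm\le C_\delta\,H_r^{-1}\Big(\frac1{|B_r(x_0)|}\int_{B_r(x_0)}H_r(u_\pm)\,dx\Big)+\delta\,h_r^{-1}\Big(r^{-s_pp}\big(\mathrm{Tail}(u;x_0,r/2)^{p-1}+1\big)\Big),$$ both for $u_+$ and for $u_-$. -/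

import Mathlib

open MeasureTheory Set

noncomputable section

/-- The Euclidean space of dimension `N`, with the Euclidean norm. -/
abbrev Eucl (N : ℕ) : Type := EuclideanSpace ℝ (Fin N)

/-- The `q`-th power of the Gagliardo seminorm of `w` on `S`, an extended nonnegative number:
the integral over `S × S` of `|w x - w y| ^ q / |x - y| ^ (N + γ q)`. -/
def gagliardo {N : ℕ} (γ q : ℝ) (S : Set (Eucl N)) (w : Eucl N → ℝ) : ENNReal :=
  ∫⁻ z in S ×ˢ S, ENNReal.ofReal (|w z.1 - w z.2| ^ q / ‖z.1 - z.2‖ ^ ((N : ℝ) + γ * q))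

/-- Membership in the fractional Sobolev space of order `γ` and exponent `q` on `S`. -/
def MemFracSobolev {N : ℕ} (γ q : ℝ) (S : Set (Eucl N)) (w : Eucl N → ℝ) : Prop :=
  MemLp w (ENNReal.ofReal q) (volume.restrict S) ∧ gagliardo γ q S w < ⊤

/-- Membership in the local fractional Sobolev space on `Ω`: membership on every open set that is
compactly contained in `Ω`. -/
def MemFracSobolevLoc {N : ℕ} (γ q : ℝ) (Ω : Set (Eucl N)) (w : Eucl N → ℝ) : Prop :=
  ∀ U : Set (Eucl N), IsOpen U → IsCompact (closure U) → closure U ⊆ Ω → MemFracSobolev γ q U w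

/-- Membership in the tail space of exponent `q` and weight index `γ`. -/
def MemTailSpace {N : ℕ} (q γ : ℝ) (w : Eucl N → ℝ) : Prop :=
  AEStronglyMeasurable w volume ∧
    LocallyIntegrable (fun x => |w x| ^ q) volume ∧
    Integrable (fun x => |w x| ^ q / (1 + ‖x‖) ^ ((N : ℝ) + γ)) volume

/-- The nonlocal tail of `u` outside the ball of centre `x₀` and radius `R`. -/
def Tail {N : ℕ} (p sp : ℝ) (u : Eucl N → ℝ) (x₀ : Eucl N) (R : ℝ) : ℝ :=
  (R ^ (sp * p) * ∫ x in (Metric.ball x₀ R)ᶜ,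
    |u x| ^ (p - 1) / ‖x - x₀‖ ^ ((N : ℝ) + sp * p)) ^ (1 / (p - 1))

/-- The set-valued sign function, with value `[-1, 1]` at `0`. -/
def sgnSet (t : ℝ) : Set ℝ := if t = 0 then Icc (-1) 1 else {Real.sign t}

/-- Weak solutions in `Ω` of the equation `(-Δ₁)^s₁ u + (-Δ_p)^s_p u = 0`. The test functions are
those of finite `W^{s₁,1}` and `W^{s_p,p}` norm on the whole space with compact support in `Ω`; for
them both integrands below are absolutely integrable, given the conditions on `u` and `Z`. -/
def IsWeakSolution {N : ℕ} (p s₁ sp : ℝ) (Ω : Set (Eucl N)) (u : Eucl N → ℝ) : Prop :=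
  MemFracSobolevLoc s₁ 1 Ω u ∧ MemFracSobolevLoc sp p Ω u ∧ MemTailSpace (p - 1) (sp * p) u ∧
  ∃ Z : Eucl N × Eucl N → ℝ,
    MemLp Z ⊤ volume ∧
    (∀ᵐ z : Eucl N × Eucl N, Z z ∈ sgnSet (u z.1 - u z.2)) ∧
    ∀ φ : Eucl N → ℝ,
      MemFracSobolev s₁ 1 univ φ → MemFracSobolev sp p univ φ →
      HasCompactSupport φ → tsupport φ ⊆ Ω →
      (∫ z : Eucl N × Eucl N,
          Z z * (φ z.1 - φ z.2) / ‖z.1 - z.2‖ ^ ((N : ℝ) + s₁)) +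
        (∫ z : Eucl N × Eucl N,
          |u z.1 - u z.2| ^ (p - 2) * (u z.1 - u z.2) * (φ z.1 - φ z.2) /
            ‖z.1 - z.2‖ ^ ((N : ℝ) + sp * p)) = 0

/-- Local boundedness in `Ω`: essentially bounded on every compact subset. -/
def IsLocallyBoundedIn {N : ℕ} (Ω : Set (Eucl N)) (u : Eucl N → ℝ) : Prop :=
  ∀ K : Set (Eucl N), IsCompact K → K ⊆ Ω →
    ∃ M : ℝ, ∀ᵐ x ∂(volume.restrict K), |u x| ≤ M

/-- `H_r(t) = t / r^s₁ + t^p / r^(s_p p)`. -/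
def bigH (p s₁ sp r t : ℝ) : ℝ := t / r ^ s₁ + t ^ p / r ^ (sp * p)

/-- `h_r(t) = 1 / r^s₁ + t^(p-1) / r^(s_p p)`. -/
def smallH (p s₁ sp r t : ℝ) : ℝ := 1 / r ^ s₁ + t ^ (p - 1) / r ^ (sp * p)

/-- The inverse of an increasing function `f` on `[0, ∞)`: the least `t ≥ 0` with `y ≤ f t`. It is
the usual inverse at the values of `f`, and it is `0` for `y` below `f 0`. -/
def incrInv (f : ℝ → ℝ) (y : ℝ) : ℝ := sInf {t : ℝ | 0 ≤ t ∧ y ≤ f t}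

theorem incrInv_apply {f : ℝ → ℝ} (hf : StrictMonoOn f (Ici 0)) {t : ℝ} (ht : 0 ≤ t) :
    incrInv f (f t) = t := by
  have h : {x : ℝ | 0 ≤ x ∧ f t ≤ f x} = Ici t := by
    ext x
    constructor
    · rintro ⟨h0, hx⟩
      exact (hf.le_iff_le ht h0).1 hx
    · intro hx
      have h0 : 0 ≤ x := le_trans ht hx
      exact ⟨h0, (hf.le_iff_le ht h0).2 hx⟩
  rw [incrInv, h, csInf_Ici]

end

/-!
De Giorgi iteration. Test the equation with `(u - k)₊ ψ^p` for a cutoff function `ψ`. The sign of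
`Z` bounds the `1`-part from below, Young's inequality the `p`-part, and together they bound the
Gagliardo seminorms of both orders of the truncated function by integrals of `H_r((u - k)₊)`, as
long as the tail is at most a multiple of `h_r(K)`, where `K` is the height up to which one
truncates. When `{u > k}` has small measure, a fractional Faber–Krahn inequality turns the seminorms
back into integrals and gains a power of that measure.

In units of `H_r(K) |B_r|`, the energies above levels increasing to `K` therefore decay
superlinearly, and they vanish in the limit once `K` exceeds a multiple of `H_r⁻¹` of the mean of
`H_r(u₊)` plus `δ` times `h_r⁻¹` of the tail. The estimate for `u₋` is the one for `-u`.
-/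

section RealPowers

variable {p s t x y : ℝ}

theorem rpow_sub_one_mul_self (hp : p ≠ 0) (hx : 0 ≤ x) : x ^ (p - 1) * x = x ^ p := by
  rw [← Real.rpow_add_one' hx (by simpa using hp), sub_add_cancel]

theorem rpow_sub_rpow_le_mul_sub (hp : 1 ≤ p) (hs : 0 ≤ s) (ht : 0 < t) :
    t ^ p - s ^ p ≤ p * t ^ (p - 1) * (t - s) := by
  have bernoulli : 1 + p * (s / t - 1) ≤ s ^ p / t ^ p := by
    have h := one_add_mul_self_le_rpow_one_add (s := s / t - 1)
      (by linarith [div_nonneg hs ht.le]) hp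
    rwa [add_sub_cancel, Real.div_rpow hs ht.le] at h
  rw [le_div_iff₀ (Real.rpow_pos_of_pos ht p)] at bernoulli
  have expand : (1 + p * (s / t - 1)) * t ^ p = t ^ p - p * t ^ (p - 1) * (t - s) := by
    rw [← rpow_sub_one_mul_self (by linarith) ht.le]
    field_simp
    ring
  linarith

theorem abs_rpow_sub_rpow_le (hp : 1 ≤ p) (hs : 0 ≤ s) (ht : 0 ≤ t) :
    |s ^ p - t ^ p| ≤ p * max s t ^ (p - 1) * |s - t| := by
  wlog hst : s ≤ t generalizing s t
  · rw [abs_sub_comm, abs_sub_comm s, max_comm]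
    exact this ht hs (le_of_not_ge hst)
  have hpow : s ^ p ≤ t ^ p := Real.rpow_le_rpow hs hst (by linarith)
  rw [abs_sub_comm, abs_sub_comm s, abs_of_nonneg (sub_nonneg.2 hpow),
    abs_of_nonneg (sub_nonneg.2 hst), max_eq_right hst]
  rcases ht.eq_or_lt with rfl | ht
  · simp [le_antisymm hst hs]
  · exact rpow_sub_rpow_le_mul_sub hp hs ht

theorem add_rpow_le_two_rpow_mul (hp : 0 ≤ p) (hx : 0 ≤ x) (hy : 0 ≤ y) :
    (x + y) ^ p ≤ 2 ^ p * (x ^ p + y ^ p) := by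
  wlog hxy : x ≤ y generalizing x y
  · rw [add_comm x, add_comm (x ^ p)]
    exact this hy hx (le_of_not_ge hxy)
  calc (x + y) ^ p ≤ (2 * y) ^ p := by gcongr; linarith
    _ = 2 ^ p * y ^ p := Real.mul_rpow zero_le_two hy
    _ ≤ 2 ^ p * (x ^ p + y ^ p) := by
      gcongr
      exact le_add_of_nonneg_left (by positivity)

theorem rpow_sub_one_mul_le_add {c : ℝ} (hp : 1 ≤ p) (hc : 0 < c) (hx : 0 ≤ x) (hy : 0 ≤ y) :
    x ^ (p - 1) * y ≤ x ^ p / c + c ^ (p - 1) * y ^ p := by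
  have hp0 : p ≠ 0 := by linarith
  rcases le_total (c * y) x with h | h
  · calc x ^ (p - 1) * y ≤ x ^ (p - 1) * (x / c) := by
          gcongr
          rwa [le_div_iff₀' hc]
      _ = x ^ p / c := by rw [← mul_div_assoc, rpow_sub_one_mul_self hp0 hx]
      _ ≤ x ^ p / c + c ^ (p - 1) * y ^ p := le_add_of_nonneg_right (by positivity)
  · calc x ^ (p - 1) * y ≤ (c * y) ^ (p - 1) * y := by gcongr
      _ = c ^ (p - 1) * y ^ p := by
          rw [Real.mul_rpow hc.le hy, mul_assoc, rpow_sub_one_mul_self hp0 hy]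
      _ ≤ x ^ p / c + c ^ (p - 1) * y ^ p := le_add_of_nonneg_left (by positivity)

theorem abs_abs_rpow_sub_two_mul_self (hp : 1 < p) (t : ℝ) :
    |(|t| ^ (p - 2) * t)| = |t| ^ (p - 1) := by
  rw [abs_mul, abs_of_nonneg (by positivity), ← Real.rpow_add_one' (abs_nonneg t) (by linarith)]
  ring_nf

theorem abs_rpow_sub_two_mul_self_of_nonneg (hp : 1 < p) (ht : 0 ≤ t) :
    |t| ^ (p - 2) * t = t ^ (p - 1) := by
  have h := abs_abs_rpow_sub_two_mul_self hp t
  rw [abs_of_nonneg (show 0 ≤ |t| ^ (p - 2) * t by positivity)] at h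
  rwa [abs_of_nonneg ht] at h ⊢

theorem neg_abs_rpow_le_of_nonneg {a b : ℝ} (hp : 1 < p) (ha : 0 ≤ a) :
    -|b| ^ (p - 1) ≤ |a - b| ^ (p - 2) * (a - b) := by
  rcases le_total b a with hba | hab
  · have : 0 ≤ a - b := sub_nonneg.2 hba
    exact (neg_nonpos.2 (by positivity)).trans (by positivity)
  · calc -|b| ^ (p - 1) ≤ -|a - b| ^ (p - 1) := by
          have : |a - b| ≤ |b| := by
            rw [abs_of_nonpos (by linarith), abs_of_nonneg (by linarith)]
            linarith
          gcongr
      _ = -|(|a - b| ^ (p - 2) * (a - b))| := by rw [abs_abs_rpow_sub_two_mul_self hp]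
      _ ≤ _ := neg_abs_le _

end RealPowers

section Sign

variable {Z t : ℝ}

theorem abs_le_one_of_mem_sgnSet (hZ : Z ∈ sgnSet t) : |Z| ≤ 1 := by
  unfold sgnSet at hZ
  split_ifs at hZ with ht
  · exact abs_le.2 hZ
  · rw [mem_singleton_iff.1 hZ]
    rcases Real.sign_apply_eq_of_ne_zero t ht with h | h <;> simp [h]

theorem neg_mem_sgnSet (hZ : Z ∈ sgnSet t) : -Z ∈ sgnSet (-t) := by
  unfold sgnSet at *
  simp only [neg_eq_zero]
  split_ifs at hZ ⊢ with ht
  · exact ⟨neg_le_neg hZ.2, neg_le.1 hZ.1⟩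
  · rw [mem_singleton_iff.1 hZ, Real.sign_neg]
    rfl

theorem mul_sub_eq_abs_of_mem_sgnSet {f : ℝ → ℝ} (hf : Monotone f) {a b : ℝ}
    (hZ : Z ∈ sgnSet (a - b)) : Z * (f a - f b) = |f a - f b| := by
  unfold sgnSet at hZ
  rcases lt_trichotomy a b with hab | rfl | hab
  · rw [if_neg (by linarith), Real.sign_of_neg (by linarith)] at hZ
    rw [hZ, abs_of_nonpos (sub_nonpos.2 (hf hab.le)), neg_one_mul]
  · simp
  · rw [if_neg (by linarith), Real.sign_of_pos (by linarith)] at hZ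
    rw [hZ, abs_of_nonneg (sub_nonneg.2 (hf hab.le)), one_mul]

end Sign

/-- The truncation `(u - k)₊` of `u` from below at the level `k`. -/
def excess {α : Type*} (u : α → ℝ) (k : ℝ) (x : α) : ℝ := max (u x - k) 0

section Excess

variable {α : Type*} {u : α → ℝ} {k : ℝ}

theorem excess_nonneg (u : α → ℝ) (k : ℝ) (x : α) : 0 ≤ excess u k x := le_max_right _ _

theorem excess_le_abs (hk : 0 ≤ k) (x : α) : excess u k x ≤ |u x| :=
  max_le (by linarith [le_abs_self (u x)]) (abs_nonneg _)

theorem abs_excess_sub_le (u : α → ℝ) (k : ℝ) (x y : α) :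
    |excess u k x - excess u k y| ≤ |u x - u y| := by
  simpa [excess] using abs_max_sub_max_le_abs (u x - k) (u y - k) 0

theorem excess_anti {l : ℝ} (h : k ≤ l) (x : α) : excess u l x ≤ excess u k x :=
  max_le_max (sub_le_sub_left h _) le_rfl

theorem excess_pos_iff {x : α} : 0 < excess u k x ↔ k < u x := by
  simp [excess]

theorem excess_le_excess {x y : α} (h : u x ≤ u y) : excess u k x ≤ excess u k y :=
  max_le_max (sub_le_sub_right h k) le_rfl

@[fun_prop]
theorem measurable_excess [MeasurableSpace α] (hu : Measurable u) : Measurable (excess u k) :=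
  (hu.sub_const k).max measurable_const

end Excess

section PointwiseCaccioppoli

variable {p s t : ℝ}

/-- Both sides are split by `w s - v t = (w - v) (s + t) / 2 + (w + v) (s - t) / 2`; the sign of
the first part is the one of `Z`. -/
theorem abs_excess_mul_sub_le_sgn_mul {α : Type*} {u : α → ℝ} {k Z : ℝ} {x y : α}
    (hZ : Z ∈ sgnSet (u x - u y)) (hs : 0 ≤ s) (ht : 0 ≤ t) :
    |excess u k x * s - excess u k y * t| ≤
      Z * (excess u k x * s - excess u k y * t) + (excess u k x + excess u k y) * |s - t| := by
  have hw := excess_nonneg u k x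
  have hv := excess_nonneg u k y
  have hsgn : Z * (excess u k x - excess u k y) = |excess u k x - excess u k y| :=
    mul_sub_eq_abs_of_mem_sgnSet (f := fun a => max (a - k) 0)
      (fun a b hab => max_le_max (sub_le_sub_right hab k) le_rfl) hZ
  generalize excess u k x = w at *
  generalize excess u k y = v at *
  have hsplit : w * s - v * t = (w - v) * ((s + t) / 2) + (w + v) / 2 * (s - t) := by ring
  have hmix : -((w + v) / 2 * |s - t|) ≤ Z * ((w + v) / 2 * (s - t)) := by
    refine neg_le.1 ((neg_le_abs _).trans ?_)
    rw [abs_mul, abs_mul, abs_of_nonneg (show 0 ≤ (w + v) / 2 by positivity)]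
    exact mul_le_of_le_one_left (by positivity) (abs_le_one_of_mem_sgnSet hZ)
  calc |w * s - v * t| ≤ |w - v| * ((s + t) / 2) + (w + v) / 2 * |s - t| := by
        rw [hsplit]
        refine (abs_add_le _ _).trans_eq ?_
        rw [abs_mul, abs_mul, abs_of_nonneg (show 0 ≤ (s + t) / 2 by positivity),
          abs_of_nonneg (show 0 ≤ (w + v) / 2 by positivity)]
    _ ≤ Z * (w * s - v * t) + (w + v) * |s - t| := by
        rw [← hsgn, hsplit]
        linarith

theorem sub_mul_max_rpow_le {v w : ℝ} (hp : 1 < p) (hv : 0 ≤ v) (hvw : v ≤ w)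
    (hs : 0 ≤ s) (ht : 0 ≤ t) :
    ((w - v) * max s t) ^ p ≤ 4 * ((w - v) ^ (p - 1) * (w * s ^ p - v * t ^ p)) +
      (2 * p) ^ p * ((w + v) * |s - t|) ^ p := by
  have hp0 : p ≠ 0 := by linarith
  have hd : 0 ≤ w - v := sub_nonneg.2 hvw
  have hw : 0 ≤ w := hv.trans hvw
  have hm : 0 ≤ max s t := le_max_of_le_left hs
  have hmax : max s t ^ p ≤ s ^ p + t ^ p := by
    rcases max_choice s t with h | h <;> rw [h]
    · exact le_add_of_nonneg_right (by positivity)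
    · exact le_add_of_nonneg_left (by positivity)
  have hpow : -(p * max s t ^ (p - 1) * |s - t|) ≤ s ^ p - t ^ p :=
    (abs_le.1 (abs_rpow_sub_rpow_le hp.le hs ht)).1
  have hyoung : ((w - v) * max s t) ^ (p - 1) * (p * ((w + v) * |s - t|)) ≤
      ((w - v) * max s t) ^ p / 2 + 2 ^ (p - 1) * (p * ((w + v) * |s - t|)) ^ p :=
    rpow_sub_one_mul_le_add hp.le two_pos (by positivity) (by positivity)
  have hconst : 2 * (2 ^ (p - 1) * (p * ((w + v) * |s - t|)) ^ p) =
      (2 * p) ^ p * ((w + v) * |s - t|) ^ p := by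
    rw [Real.mul_rpow (by linarith) (by positivity), Real.mul_rpow zero_le_two (by linarith),
      ← rpow_sub_one_mul_self hp0 zero_le_two]
    ring
  have hmain : ((w - v) * max s t) ^ p ≤ 2 * ((w - v) ^ (p - 1) * (w * s ^ p - v * t ^ p)) +
      ((w - v) * max s t) ^ (p - 1) * (p * ((w + v) * |s - t|)) := by
    calc ((w - v) * max s t) ^ p = (w - v) ^ (p - 1) * ((w - v) * max s t ^ p) := by
          rw [Real.mul_rpow hd hm, ← rpow_sub_one_mul_self hp0 hd, mul_assoc]
      _ ≤ (w - v) ^ (p - 1) * (2 * (w * s ^ p - v * t ^ p) +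
            (w + v) * (p * max s t ^ (p - 1) * |s - t|)) := by
          gcongr
          linarith [mul_le_mul_of_nonneg_left hmax hd,
            mul_le_mul_of_nonneg_left hpow (add_nonneg hw hv)]
      _ = _ := by
          rw [Real.mul_rpow hd hm]
          ring
  linarith

theorem abs_mul_sub_rpow_le {v w : ℝ} (hp : 1 < p) (hv : 0 ≤ v) (hvw : v ≤ w)
    (hs : 0 ≤ s) (ht : 0 ≤ t) :
    |w * s - v * t| ^ p ≤ 2 ^ p * (4 * ((w - v) ^ (p - 1) * (w * s ^ p - v * t ^ p)) +
      ((2 * p) ^ p + 1) * ((w + v) * |s - t|) ^ p) := by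
  have hw : 0 ≤ w := hv.trans hvw
  have hd : 0 ≤ w - v := sub_nonneg.2 hvw
  have hsplit : |w * s - v * t| ≤ (w - v) * max s t + (w + v) * |s - t| := by
    rw [show w * s - v * t = (w - v) * t + w * (s - t) by ring]
    refine (abs_add_le _ _).trans ?_
    rw [abs_mul, abs_mul, abs_of_nonneg hw, abs_of_nonneg hd, abs_of_nonneg ht]
    gcongr
    · exact le_max_right _ _
    · exact le_add_of_nonneg_right hv
  have hmain := sub_mul_max_rpow_le hp hv hvw hs ht
  calc |w * s - v * t| ^ p ≤ ((w - v) * max s t + (w + v) * |s - t|) ^ p := by gcongr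
    _ ≤ 2 ^ p * (((w - v) * max s t) ^ p + ((w + v) * |s - t|) ^ p) :=
        add_rpow_le_two_rpow_mul (by linarith) (by positivity) (by positivity)
    _ ≤ _ := mul_le_mul_of_nonneg_left (by linarith) (by positivity)

theorem excess_sub_rpow_mul_le {α : Type*} {u : α → ℝ} {k : ℝ} {x y : α} (hp : 1 < p)
    (hyx : u y ≤ u x) (hs : 0 ≤ s) :
    (excess u k x - excess u k y) ^ (p - 1) * (excess u k x * s ^ p - excess u k y * t ^ p) ≤
      (u x - u y) ^ (p - 1) * (excess u k x * s ^ p - excess u k y * t ^ p) := by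
  rcases le_total (u y) k with hyk | hky
  · have hle : excess u k x - excess u k y ≤ u x - u y :=
      (le_abs_self _).trans
        ((abs_excess_sub_le u k x y).trans_eq (abs_of_nonneg (sub_nonneg.2 hyx)))
    have hy : excess u k y = 0 := max_eq_right (sub_nonpos.2 hyk)
    have hx := excess_nonneg u k x
    rw [hy, sub_zero] at hle ⊢
    rw [zero_mul, sub_zero]
    gcongr
  · have hx : excess u k x = u x - k := max_eq_left (sub_nonneg.2 (hky.trans hyx))
    have hy : excess u k y = u y - k := max_eq_left (sub_nonneg.2 hky)
    rw [hx, hy, sub_sub_sub_cancel_right]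

theorem abs_excess_mul_sub_rpow_le {α : Type*} {u : α → ℝ} {k : ℝ} {x y : α} (hp : 1 < p)
    (hs : 0 ≤ s) (ht : 0 ≤ t) :
    |excess u k x * s - excess u k y * t| ^ p ≤
      2 ^ p * (4 * (|u x - u y| ^ (p - 2) * (u x - u y) *
        (excess u k x * s ^ p - excess u k y * t ^ p)) +
      ((2 * p) ^ p + 1) * ((excess u k x + excess u k y) * |s - t|) ^ p) := by
  wlog hyx : u y ≤ u x generalizing x y s t
  · have h := this (x := y) (y := x) ht hs (le_of_not_ge hyx)
    rw [abs_sub_comm, abs_sub_comm s, abs_sub_comm (u x), add_comm (excess u k x)]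
    exact h.trans_eq (by ring)
  rw [abs_rpow_sub_two_mul_self_of_nonneg hp (sub_nonneg.2 hyx)]
  refine (abs_mul_sub_rpow_le hp (excess_nonneg u k y) (excess_le_excess hyx) hs ht).trans ?_
  have := excess_sub_rpow_mul_le (k := k) (t := t) hp hyx hs
  gcongr

end PointwiseCaccioppoli

section ProductIntegrals

variable {α β : Type*} [MeasurableSpace α] [MeasurableSpace β] {μ : Measure α} {ν : Measure β}

theorem lintegral_fst_mul_le [SFinite ν] {g : α → ENNReal} (hg : Measurable g)
    {κ : α × β → ENNReal} (hκ : Measurable κ) {K : ENNReal}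
    (hK : ∀ x, g x ≠ 0 → ∫⁻ y, κ (x, y) ∂ν ≤ K) :
    ∫⁻ z, g z.1 * κ z ∂μ.prod ν ≤ (∫⁻ x, g x ∂μ) * K := by
  rw [lintegral_prod _ (by fun_prop), ← lintegral_mul_const _ hg]
  refine lintegral_mono fun x => ?_
  simp only [lintegral_const_mul (g x) (show Measurable fun y => κ (x, y) by fun_prop)]
  rcases eq_or_ne (g x) 0 with h | h
  · simp [h]
  · gcongr
    exact hK x h

theorem lintegral_add_swap [SFinite μ] {f : α × α → ENNReal} (hf : Measurable f) :
    ∫⁻ z, (f z + f z.swap) ∂μ.prod μ = 2 * ∫⁻ z, f z ∂μ.prod μ := by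
  rw [lintegral_add_left hf, lintegral_prod_swap, two_mul]

theorem lintegral_ofReal_indicator {f : α → ℝ} {s : Set α} (hs : MeasurableSet s) :
    ∫⁻ x, ENNReal.ofReal (s.indicator f x) ∂μ = ∫⁻ x in s, ENNReal.ofReal (f x) ∂μ := by
  rw [← lintegral_indicator hs]
  exact lintegral_congr fun x =>
    (congrFun (indicator_comp_of_zero (g := ENNReal.ofReal) ENNReal.ofReal_zero) x).symm

theorem lintegral_le_of_integral_eq_zero {F G R : α → ℝ} (hF : Integrable F μ)
    (h0 : ∫ x, F x ∂μ = 0) (hR : AEStronglyMeasurable R μ) (hR0 : 0 ≤ R) (hG0 : 0 ≤ G)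
    (h : ∀ᵐ x ∂μ, G x ≤ F x + R x) :
    ∫⁻ x, ENNReal.ofReal (G x) ∂μ ≤ ∫⁻ x, ENNReal.ofReal (R x) ∂μ := by
  by_cases hfin : ∫⁻ x, ENNReal.ofReal (R x) ∂μ = ⊤
  · simp [hfin]
  have hRi : Integrable R μ :=
    (lintegral_ofReal_ne_top_iff_integrable hR (ae_of_all _ hR0)).1 hfin
  calc ∫⁻ x, ENNReal.ofReal (G x) ∂μ ≤ ∫⁻ x, ENNReal.ofReal (F x + R x) ∂μ :=
        lintegral_mono_ae (h.mono fun x hx => ENNReal.ofReal_le_ofReal hx)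
    _ = ENNReal.ofReal (∫ x, (F x + R x) ∂μ) :=
        (ofReal_integral_eq_lintegral_ofReal (hF.add hRi)
          (h.mono fun x hx => (hG0 x).trans hx)).symm
    _ = ENNReal.ofReal (∫ x, R x ∂μ) := by rw [integral_add hF hRi, h0, zero_add]
    _ = _ := ofReal_integral_eq_lintegral_ofReal hRi (ae_of_all _ hR0)

end ProductIntegrals

section Gagliardo

variable {N : ℕ} {a γ q : ℝ} {f u : Eucl N → ℝ}

/-- The integrand of the Gagliardo seminorm, with `a = γ q` in the exponent of the kernel. -/
noncomputable def diffQuot (a q : ℝ) (f : Eucl N → ℝ) (z : Eucl N × Eucl N) : ℝ :=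
  |f z.1 - f z.2| ^ q / ‖z.1 - z.2‖ ^ ((N : ℝ) + a)

theorem diffQuot_nonneg (z : Eucl N × Eucl N) : 0 ≤ diffQuot a q f z := by
  unfold diffQuot
  positivity

@[fun_prop]
theorem measurable_diffQuot (hf : Measurable f) : Measurable (diffQuot a q f) := by
  unfold diffQuot
  fun_prop

theorem gagliardo_univ :
    gagliardo γ q univ f = ∫⁻ z, ENNReal.ofReal (diffQuot (γ * q) q f z) := by
  rw [gagliardo, univ_prod_univ, Measure.restrict_univ]
  rfl

theorem gagliardo_univ_one :
    gagliardo γ 1 univ f = ∫⁻ z, ENNReal.ofReal (diffQuot γ 1 f z) := by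
  rw [gagliardo_univ, mul_one]

theorem lintegral_indicator_diffQuot {B : Set (Eucl N)} (hB : MeasurableSet B) :
    ∫⁻ z, ENNReal.ofReal ((B ×ˢ B).indicator (diffQuot (γ * q) q f) z) = gagliardo γ q B f :=
  lintegral_ofReal_indicator (hB.prod hB)

theorem MemFracSobolev.lintegral_rpow_lt_top {S : Set (Eucl N)} (hq : 0 < q)
    (h : MemFracSobolev γ q S u) : ∫⁻ x in S, ENNReal.ofReal (|u x| ^ q) < ⊤ := by
  have hfin := lintegral_rpow_enorm_lt_top_of_eLpNorm_lt_top (by simpa using hq) (by simp) h.1.2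
  rw [ENNReal.toReal_ofReal hq.le] at hfin
  simpa only [Real.enorm_eq_ofReal_abs, ENNReal.ofReal_rpow_of_nonneg (abs_nonneg _) hq.le]
    using hfin

end Gagliardo

section FaberKrahn

theorem half_le_measure_sdiff {α : Type*} [MeasurableSpace α] {μ : Measure α} {s t : Set α}
    (ht : μ t ≠ ⊤) (h : μ s ≤ μ t / 2) : μ t / 2 ≤ μ (t \ s) :=
  calc μ t / 2 = μ t - μ t / 2 := (ENNReal.sub_half ht).symm
    _ ≤ μ t - μ s := tsub_le_tsub_left h _
    _ ≤ μ (t \ s) := le_measure_sdiff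

variable {N : ℕ} {γ q : ℝ} {f : Eucl N → ℝ} {R : ℝ}

theorem volume_ball_eq (x : Eucl N) (hR : 0 < R) : volume (Metric.ball x R) =
    ENNReal.ofReal (volume.real (Metric.ball (0 : Eucl N) 1) * R ^ N) := by
  rw [Measure.addHaar_ball_of_pos volume x hR, finrank_euclideanSpace_fin, mul_comm,
    ENNReal.ofReal_mul measureReal_nonneg, Measure.real,
    ENNReal.ofReal_toReal measure_ball_lt_top.ne]

theorem volume_real_unitBall_pos : 0 < volume.real (Metric.ball (0 : Eucl N) 1) :=
  ENNReal.toReal_pos (Metric.measure_ball_pos _ _ one_pos).ne' measure_ball_lt_top.ne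

theorem volume_ball_div_two_eq (x : Eucl N) (hR : 0 < R) : volume (Metric.ball x R) / 2 =
    ENNReal.ofReal (volume.real (Metric.ball (0 : Eucl N) 1) * R ^ N / 2) := by
  rw [volume_ball_eq x hR, ENNReal.ofReal_div_of_pos two_pos, ENNReal.ofReal_ofNat]

theorem mul_volume_ball_sdiff_support_le {a : ℝ} (ha : 0 ≤ (N : ℝ) + a) (hq : 0 < q)
    (hf : Measurable f) (x : Eucl N) :
    ENNReal.ofReal (|f x| ^ q / R ^ ((N : ℝ) + a)) *
        volume (Metric.ball x R \ Function.support f) ≤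
      ∫⁻ y, ENNReal.ofReal (diffQuot a q f (x, y)) := by
  rcases eq_or_ne (f x) 0 with hx | hx
  · simp [hx, Real.zero_rpow hq.ne']
  rw [← setLIntegral_const]
  refine (setLIntegral_mono' (Metric.isOpen_ball.measurableSet.diff
    (measurableSet_support hf)) fun y hy => ENNReal.ofReal_le_ofReal ?_).trans
    (setLIntegral_le_lintegral _ _)
  have hy0 : f y = 0 := by simpa using hy.2
  have : 0 < ‖x - y‖ := norm_sub_pos_iff.2 (by rintro rfl; exact hx hy0)
  have : ‖x - y‖ ≤ R := by
    rw [← dist_eq_norm]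
    exact (Metric.mem_ball'.1 hy.1).le
  rw [diffQuot, hy0, sub_zero]
  gcongr

theorem lintegral_rpow_le_gagliardo (hγ : 0 < γ) (hq : 0 < q) (hR : 0 < R) (hf : Measurable f)
    (hfR : volume (Function.support f) ≤ volume (Metric.ball (0 : Eucl N) R) / 2) :
    ∫⁻ x, ENNReal.ofReal (|f x| ^ q) ≤
      ENNReal.ofReal (2 / volume.real (Metric.ball (0 : Eucl N) 1) * R ^ (γ * q)) *
        gagliardo γ q univ f := by
  set ω := volume.real (Metric.ball (0 : Eucl N) 1)
  have hω : 0 < ω := volume_real_unitBall_pos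
  have hhalf (x : Eucl N) : ENNReal.ofReal (ω * R ^ N / 2) ≤
      volume (Metric.ball x R \ Function.support f) := by
    rw [← volume_ball_div_two_eq x hR]
    refine half_le_measure_sdiff measure_ball_lt_top.ne ?_
    rwa [volume_ball_div_two_eq x hR, ← volume_ball_div_two_eq 0 hR]
  have hpoint (x : Eucl N) : ENNReal.ofReal (|f x| ^ q) ≤
      ENNReal.ofReal (2 / ω * R ^ (γ * q)) *
        ∫⁻ y, ENNReal.ofReal (diffQuot (γ * q) q f (x, y)) :=
    calc ENNReal.ofReal (|f x| ^ q)
        = ENNReal.ofReal (2 / ω * R ^ (γ * q)) *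
          (ENNReal.ofReal (|f x| ^ q / R ^ ((N : ℝ) + γ * q)) *
            ENNReal.ofReal (ω * R ^ N / 2)) := by
          rw [← ENNReal.ofReal_mul (by positivity), ← ENNReal.ofReal_mul (by positivity),
            Real.rpow_add hR, Real.rpow_natCast]
          congr 1
          field_simp
      _ ≤ _ := by
          gcongr
          exact (mul_le_mul_right (hhalf x) _).trans
            (mul_volume_ball_sdiff_support_le (by positivity) hq hf x)
  calc ∫⁻ x, ENNReal.ofReal (|f x| ^ q)
      ≤ ∫⁻ x, ENNReal.ofReal (2 / ω * R ^ (γ * q)) *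
          ∫⁻ y, ENNReal.ofReal (diffQuot (γ * q) q f (x, y)) := lintegral_mono hpoint
    _ = _ := by
        rw [lintegral_const_mul' _ _ ENNReal.ofReal_ne_top, gagliardo_univ,
          Measure.volume_eq_prod, lintegral_prod _ (by fun_prop)]

/-- A fractional Faber–Krahn inequality: half of the ball of radius `(2 θ) ^ (1 / N) * r` around
any point misses the support of `f`, and there the difference quotient at `x` controls `|f x|`. -/
theorem exists_lintegral_rpow_le_gagliardo [NeZero N] (hγ : 0 < γ) (hq : 0 < q) :
    ∃ C : ℝ, 0 < C ∧ ∀ f : Eucl N → ℝ, Measurable f → ∀ θ r : ℝ, 0 < θ → 0 < r →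
      ∀ x₀ : Eucl N, volume (Function.support f) ≤ ENNReal.ofReal θ * volume (Metric.ball x₀ r) →
      ∫⁻ x, ENNReal.ofReal (|f x| ^ q) ≤
        ENNReal.ofReal (C * θ ^ (γ * q / N) * r ^ (γ * q)) * gagliardo γ q univ f := by
  set ω := volume.real (Metric.ball (0 : Eucl N) 1)
  have : 0 < ω := volume_real_unitBall_pos
  refine ⟨2 / ω * 2 ^ (γ * q / N), by positivity, fun f hf θ r hθ hr x₀ hsupp => ?_⟩
  set R : ℝ := (2 * θ) ^ (1 / (N : ℝ)) * r with hR
  have hR0 : 0 < R := by positivity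
  have hRN : R ^ N = 2 * θ * r ^ N := by
    rw [hR, mul_pow, one_div, Real.rpow_inv_natCast_pow (by positivity) (NeZero.ne N)]
  have hRγ : R ^ (γ * q) = 2 ^ (γ * q / N) * θ ^ (γ * q / N) * r ^ (γ * q) := by
    rw [hR, Real.mul_rpow (by positivity) hr.le, ← Real.rpow_mul (by positivity),
      ← Real.mul_rpow two_pos.le hθ.le, one_div_mul_eq_div]
  have hhalf : volume (Metric.ball (0 : Eucl N) R) / 2 =
      ENNReal.ofReal θ * volume (Metric.ball x₀ r) := by
    rw [volume_ball_div_two_eq 0 hR0, volume_ball_eq x₀ hr, ← ENNReal.ofReal_mul hθ.le, hRN]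
    congr 1
    ring
  convert lintegral_rpow_le_gagliardo hγ hq hR0 hf (hsupp.trans_eq hhalf.symm) using 3
  rw [hRγ]
  ring

end FaberKrahn

section TruncatedKernel

variable {N : ℕ} {a q L : ℝ}

/-- The kernel `‖x - y‖ ^ (-(N + a))`, tempered near the diagonal at the scale `1 / L`. This is what
is left of the kernel after multiplication by the `q`-th power of the increment of a cutoff. -/
noncomputable def truncKernel (a q L : ℝ) (z : Eucl N × Eucl N) : ℝ :=
  (min 1 (L * ‖z.1 - z.2‖)) ^ q / ‖z.1 - z.2‖ ^ ((N : ℝ) + a)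

theorem truncKernel_nonneg (hL : 0 ≤ L) (z : Eucl N × Eucl N) : 0 ≤ truncKernel a q L z := by
  unfold truncKernel
  positivity

@[fun_prop]
theorem measurable_truncKernel : Measurable (truncKernel a q L : Eucl N × Eucl N → ℝ) := by
  unfold truncKernel
  fun_prop

theorem truncKernel_swap (z : Eucl N × Eucl N) :
    truncKernel a q L z.swap = truncKernel a q L z := by
  simp only [truncKernel, Prod.fst_swap, Prod.snd_swap, norm_sub_rev]

theorem integrable_min_one_norm_rpow_div [NeZero N] (ha : 0 < a) (haq : a < q) :
    Integrable fun z : Eucl N => (min 1 ‖z‖) ^ q / ‖z‖ ^ ((N : ℝ) + a) := by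
  have hpolar {t : ℝ} (ht : 0 < t) : t ^ (N - 1) * (t ^ ((N : ℝ) + a))⁻¹ = t ^ (-1 - a) := by
    rw [← Real.rpow_natCast, ← Real.rpow_neg ht.le, ← Real.rpow_add ht,
      Nat.cast_sub (NeZero.one_le (n := N))]
    congr 1
    push_cast
    ring
  rw [integrable_fun_norm_addHaar volume (f := fun t => (min 1 t) ^ q / t ^ ((N : ℝ) + a)),
    finrank_euclideanSpace_fin, ← Ioc_union_Ioi_eq_Ioi (zero_le_one' ℝ)]
  refine IntegrableOn.union ?_ ?_
  · have hnear : IntegrableOn (fun t : ℝ => t ^ (q - 1 - a)) (Ioc 0 1) := by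
      rw [integrableOn_Ioc_iff_integrableOn_Ioo,
        intervalIntegral.integrableOn_Ioo_rpow_iff one_pos]
      linarith
    refine hnear.congr_fun (fun t ht => ?_) measurableSet_Ioc
    simp only [smul_eq_mul, min_eq_right ht.2]
    rw [div_eq_mul_inv, mul_left_comm, hpolar ht.1, ← Real.rpow_add ht.1]
    congr 1
    ring
  · have hfar : IntegrableOn (fun t : ℝ => t ^ (-1 - a)) (Ioi 1) :=
      integrableOn_Ioi_rpow_of_lt (by linarith) one_pos
    refine hfar.congr_fun (fun t ht => ?_) measurableSet_Ioi
    simp only [smul_eq_mul, min_eq_left (mem_Ioi.1 ht).le, Real.one_rpow, one_div]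
    rw [hpolar (one_pos.trans ht)]

theorem lintegral_truncKernel_scale (hL : 0 < L) (x : Eucl N) :
    ∫⁻ y, ENNReal.ofReal (truncKernel a q L (x, y)) =
      ENNReal.ofReal (L ^ a) *
        ∫⁻ z : Eucl N, ENNReal.ofReal ((min 1 ‖z‖) ^ q / ‖z‖ ^ ((N : ℝ) + a)) := by
  set F : Eucl N → ENNReal :=
    fun z => ENNReal.ofReal ((min 1 ‖z‖) ^ q / ‖z‖ ^ ((N : ℝ) + a)) with hF
  have hscale (z : Eucl N) : ENNReal.ofReal ((min 1 (L * ‖z‖)) ^ q / ‖z‖ ^ ((N : ℝ) + a)) =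
      ENNReal.ofReal (L ^ ((N : ℝ) + a)) * F (L • z) := by
    rw [hF, ← ENNReal.ofReal_mul (by positivity), norm_smul, Real.norm_of_nonneg hL.le,
      Real.mul_rpow hL.le (norm_nonneg _)]
    congr 1
    field_simp
  have hmap : ∫⁻ z, F (L • z) = ENNReal.ofReal (L ^ N)⁻¹ * ∫⁻ z, F z := by
    rw [← lintegral_map (f := F) (by fun_prop) (measurable_const_smul L),
      Measure.map_addHaar_smul volume hL.ne', lintegral_smul_measure,
      finrank_euclideanSpace_fin, abs_of_nonneg (by positivity), smul_eq_mul]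
  calc ∫⁻ y, ENNReal.ofReal (truncKernel a q L (x, y))
      = ∫⁻ z : Eucl N, ENNReal.ofReal ((min 1 (L * ‖z‖)) ^ q / ‖z‖ ^ ((N : ℝ) + a)) :=
        lintegral_sub_left_eq_self
          (fun z : Eucl N => ENNReal.ofReal ((min 1 (L * ‖z‖)) ^ q / ‖z‖ ^ ((N : ℝ) + a))) x
    _ = ENNReal.ofReal (L ^ ((N : ℝ) + a)) * (ENNReal.ofReal (L ^ N)⁻¹ * ∫⁻ z, F z) := by
        simp only [hscale]
        rw [lintegral_const_mul _ (by fun_prop), hmap]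
    _ = ENNReal.ofReal (L ^ a) * ∫⁻ z, F z := by
        rw [← mul_assoc, ← ENNReal.ofReal_mul (by positivity), Real.rpow_add hL,
          Real.rpow_natCast]
        congr 2
        field_simp

theorem exists_lintegral_truncKernel_le [NeZero N] (ha : 0 < a) (haq : a < q) :
    ∃ C : ℝ, 0 < C ∧ ∀ L : ℝ, 0 < L → ∀ x : Eucl N,
      ∫⁻ y, ENNReal.ofReal (truncKernel a q L (x, y)) ≤ ENNReal.ofReal (C * L ^ a) := by
  set I : ℝ := ∫ z : Eucl N, (min 1 ‖z‖) ^ q / ‖z‖ ^ ((N : ℝ) + a)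
  have : 0 ≤ I := integral_nonneg fun z => by positivity
  refine ⟨I + 1, by positivity, fun L hL x => ?_⟩
  rw [lintegral_truncKernel_scale hL, ← ofReal_integral_eq_lintegral_ofReal
    (integrable_min_one_norm_rpow_div ha haq) (ae_of_all _ fun z => by positivity),
    ← ENNReal.ofReal_mul (by positivity), mul_comm]
  gcongr
  linarith

end TruncatedKernel

/-- A cutoff function for `B` at the scale `1 / L`: it takes values in `[0, 1]`, is `L`-Lipschitz,
and its support has distance at least `1 / L` to the complement of `B`. -/
structure IsCutoff {N : ℕ} (B : Set (Eucl N)) (L : ℝ) (ψ : Eucl N → ℝ) : Prop where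
  mem_Icc : ∀ x, ψ x ∈ Icc (0 : ℝ) 1
  abs_sub_le : ∀ x y, |ψ x - ψ y| ≤ min 1 (L * ‖x - y‖)
  gap : ∀ x y, ψ x ≠ 0 → y ∉ B → 1 ≤ L * ‖x - y‖

namespace IsCutoff

variable {N : ℕ} {B : Set (Eucl N)} {L : ℝ} {ψ : Eucl N → ℝ}

theorem eq_zero (hψ : IsCutoff B L ψ) {x : Eucl N} (hx : x ∉ B) : ψ x = 0 := by
  by_contra h0
  have := hψ.gap x x h0 hx
  norm_num at this

theorem min_nonneg (hψ : IsCutoff B L ψ) (x y : Eucl N) : 0 ≤ min 1 (L * ‖x - y‖) :=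
  (abs_nonneg _).trans (hψ.abs_sub_le x y)

theorem continuous (hψ : IsCutoff B L ψ) : Continuous ψ := by
  refine (LipschitzWith.of_dist_le_mul (K := L.toNNReal) fun x y => ?_).continuous
  rw [Real.dist_eq, dist_eq_norm, Real.coe_toNNReal']
  calc |ψ x - ψ y| ≤ L * ‖x - y‖ := (hψ.abs_sub_le x y).trans (min_le_right _ _)
    _ ≤ max L 0 * ‖x - y‖ := by gcongr; exact le_max_left _ _

theorem rpow (hψ : IsCutoff B L ψ) {p : ℝ} (hp : 1 ≤ p) :
    IsCutoff B (p * L) (fun x => ψ x ^ p) where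
  mem_Icc x := ⟨Real.rpow_nonneg (hψ.mem_Icc x).1 _,
    Real.rpow_le_one (hψ.mem_Icc x).1 (hψ.mem_Icc x).2 (by linarith)⟩
  abs_sub_le x y := by
    obtain ⟨hx0, hx1⟩ := hψ.mem_Icc x
    obtain ⟨hy0, hy1⟩ := hψ.mem_Icc y
    refine le_min ?_ ?_
    · exact abs_sub_le_of_nonneg_of_le (Real.rpow_nonneg hx0 _)
        (Real.rpow_le_one hx0 hx1 (by linarith)) (Real.rpow_nonneg hy0 _)
        (Real.rpow_le_one hy0 hy1 (by linarith))
    · calc |ψ x ^ p - ψ y ^ p| ≤ p * max (ψ x) (ψ y) ^ (p - 1) * |ψ x - ψ y| :=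
            abs_rpow_sub_rpow_le hp hx0 hy0
        _ ≤ p * 1 * (L * ‖x - y‖) := by
            gcongr
            · exact Real.rpow_le_one (le_max_of_le_left hx0) (max_le hx1 hy1) (by linarith)
            · exact (hψ.abs_sub_le x y).trans (min_le_right _ _)
        _ = p * L * ‖x - y‖ := by ring
  gap x y hx hy := by
    have hgap := hψ.gap x y (fun h0 => hx (by simp [h0, Real.zero_rpow (by linarith : p ≠ 0)])) hy
    rw [mul_assoc]
    exact one_le_mul_of_one_le_of_one_le hp hgap

@[elab_as_elim]
theorem pair_induction (hψ : IsCutoff B L ψ) {P : Eucl N → Eucl N → Prop}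
    (symm : ∀ x y, P x y → P y x) (inside : ∀ x ∈ B, ∀ y ∈ B, P x y)
    (across : ∀ x ∈ B, ∀ y ∉ B, ψ y = 0 → min 1 (L * ‖x - y‖) = 1 → P x y)
    (outside : ∀ x y, ψ x = 0 → ψ y = 0 → P x y) (x y : Eucl N) : P x y := by
  have hacross : ∀ x ∈ B, ∀ y ∉ B, P x y := fun x hx y hy => by
    rcases eq_or_ne (ψ x) 0 with h0 | h0
    · exact outside x y h0 (hψ.eq_zero hy)
    · exact across x hx y hy (hψ.eq_zero hy) (min_eq_left (hψ.gap x y h0 hy))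
  by_cases hx : x ∈ B <;> by_cases hy : y ∈ B
  · exact inside x hx y hy
  · exact hacross x hx y hy
  · exact symm y x (hacross y hy x hx)
  · exact outside x y (hψ.eq_zero hx) (hψ.eq_zero hy)

variable {k q : ℝ} {u : Eucl N → ℝ}

theorem excess_mul_nonneg (hψ : IsCutoff B L ψ) (x : Eucl N) : 0 ≤ excess u k x * ψ x :=
  mul_nonneg (excess_nonneg u k x) (hψ.mem_Icc x).1

theorem excess_mul_le_indicator (hψ : IsCutoff B L ψ) (x : Eucl N) :
    excess u k x * ψ x ≤ B.indicator (excess u k) x := by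
  by_cases hx : x ∈ B
  · simpa only [indicator_of_mem hx] using
      mul_le_of_le_one_right (excess_nonneg u k x) (hψ.mem_Icc x).2
  · simp [hx, hψ.eq_zero hx]

theorem excess_mul_le_abs (hψ : IsCutoff B L ψ) (hk : 0 ≤ k) (x : Eucl N) :
    excess u k x * ψ x ≤ |u x| :=
  (mul_le_of_le_one_right (excess_nonneg u k x) (hψ.mem_Icc x).2).trans (excess_le_abs hk x)

theorem abs_excess_mul_sub_le (hψ : IsCutoff B L ψ) (hk : 0 ≤ k) (x y : Eucl N) :
    |excess u k x * ψ x - excess u k y * ψ y| ≤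
      |u x - u y| + |u y| * min 1 (L * ‖x - y‖) := by
  have hsplit : excess u k x * ψ x - excess u k y * ψ y =
    (excess u k x - excess u k y) * ψ x + excess u k y * (ψ x - ψ y) := by ring
  rw [hsplit]
  refine (abs_add_le _ _).trans (add_le_add ?_ ?_)
  · rw [abs_mul, abs_of_nonneg (hψ.mem_Icc x).1]
    exact (mul_le_of_le_one_right (abs_nonneg _) (hψ.mem_Icc x).2).trans
      (abs_excess_sub_le u k x y)
  · rw [abs_mul, abs_of_nonneg (excess_nonneg u k y)]
    exact mul_le_mul (excess_le_abs hk y) (hψ.abs_sub_le x y) (abs_nonneg _) (abs_nonneg _)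

end IsCutoff

section PairTerms

variable {N : ℕ} {a p q L k : ℝ} {B : Set (Eucl N)} {u f g ψ : Eucl N → ℝ} {z : Eucl N × Eucl N}

/-- The error produced by differentiating a cutoff function: `g` restricted to `B`, at both points
of the pair `z`, times the truncated kernel. -/
noncomputable def localTerm (a q L : ℝ) (B : Set (Eucl N)) (g : Eucl N → ℝ)
    (z : Eucl N × Eucl N) : ℝ :=
  (B.indicator g z.1 + B.indicator g z.2) * truncKernel a q L z

/-- The interaction of `f` with `|u| ^ (p - 1)` outside `B`, symmetric in the two points. -/
noncomputable def tailTerm (a p : ℝ) (B : Set (Eucl N)) (u f : Eucl N → ℝ)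
    (z : Eucl N × Eucl N) : ℝ :=
  (f z.1 * Bᶜ.indicator (fun y => |u y| ^ (p - 1)) z.2 +
    f z.2 * Bᶜ.indicator (fun y => |u y| ^ (p - 1)) z.1) / ‖z.1 - z.2‖ ^ ((N : ℝ) + a)

/-- The integrand of the `1`-Laplacian part of the weak formulation. -/
noncomputable def sgnForm (a : ℝ) (Z : Eucl N × Eucl N → ℝ) (φ : Eucl N → ℝ)
    (z : Eucl N × Eucl N) : ℝ :=
  Z z * (φ z.1 - φ z.2) / ‖z.1 - z.2‖ ^ ((N : ℝ) + a)

/-- The integrand of the `p`-Laplacian part of the weak formulation. -/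
noncomputable def powForm (a p : ℝ) (u φ : Eucl N → ℝ) (z : Eucl N × Eucl N) : ℝ :=
  |u z.1 - u z.2| ^ (p - 2) * (u z.1 - u z.2) * (φ z.1 - φ z.2) / ‖z.1 - z.2‖ ^ ((N : ℝ) + a)

theorem localTerm_nonneg (hL : 0 ≤ L) (hg : ∀ x, 0 ≤ g x) (z : Eucl N × Eucl N) :
    0 ≤ localTerm a q L B g z :=
  mul_nonneg (add_nonneg (indicator_nonneg (fun x _ => hg x) _)
    (indicator_nonneg (fun x _ => hg x) _)) (truncKernel_nonneg hL z)

theorem measurable_localTerm (hB : MeasurableSet B) (hg : Measurable g) :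
    Measurable (localTerm a q L B g) := by
  have := hg.indicator hB
  unfold localTerm
  fun_prop

theorem exists_lintegral_localTerm_le [NeZero N] (ha : 0 < a) (haq : a < q) :
    ∃ C > 0, ∀ L > 0, ∀ {B : Set (Eucl N)}, MeasurableSet B → ∀ {g : Eucl N → ℝ}, Measurable g →
      (∀ x, 0 ≤ g x) → ∫⁻ z, ENNReal.ofReal (localTerm a q L B g z) ≤
        ENNReal.ofReal (C * L ^ a) * ∫⁻ x in B, ENNReal.ofReal (g x) := by
  obtain ⟨C, hC, hker⟩ := exists_lintegral_truncKernel_le (N := N) ha haq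
  refine ⟨2 * C, by positivity, fun L hL B hB g hg hg0 => ?_⟩
  have : Measurable (B.indicator g) := hg.indicator hB
  have hgB0 : ∀ x, 0 ≤ B.indicator g x := indicator_nonneg fun x _ => hg0 x
  have hsplit : ∀ z, ENNReal.ofReal (localTerm a q L B g z) =
      ENNReal.ofReal (B.indicator g z.1) * ENNReal.ofReal (truncKernel a q L z) +
        ENNReal.ofReal (B.indicator g z.swap.1) * ENNReal.ofReal (truncKernel a q L z.swap) :=
    fun z => by
      have := truncKernel_nonneg (a := a) (q := q) hL.le z
      rw [localTerm, truncKernel_swap, Prod.fst_swap, ← add_mul,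
        ← ENNReal.ofReal_add (hgB0 _) (hgB0 _), ENNReal.ofReal_mul (add_nonneg (hgB0 _) (hgB0 _))]
  calc ∫⁻ z, ENNReal.ofReal (localTerm a q L B g z)
      = 2 * ∫⁻ z : Eucl N × Eucl N,
          ENNReal.ofReal (B.indicator g z.1) * ENNReal.ofReal (truncKernel a q L z) := by
        simp only [hsplit]
        exact lintegral_add_swap (by fun_prop)
    _ ≤ 2 * ((∫⁻ x, ENNReal.ofReal (B.indicator g x)) * ENNReal.ofReal (C * L ^ a)) := by
        gcongr
        exact lintegral_fst_mul_le (κ := fun z => ENNReal.ofReal (truncKernel a q L z))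
          (by fun_prop) (by fun_prop) fun x _ => hker L hL x
    _ = ENNReal.ofReal (2 * C * L ^ a) * ∫⁻ x in B, ENNReal.ofReal (g x) := by
        rw [lintegral_ofReal_indicator hB, mul_assoc 2 C, ENNReal.ofReal_mul zero_le_two,
          ENNReal.ofReal_ofNat]
        ring

theorem tailTerm_nonneg (hf : ∀ x, 0 ≤ f x) (z : Eucl N × Eucl N) : 0 ≤ tailTerm a p B u f z := by
  have hu : ∀ x, 0 ≤ Bᶜ.indicator (fun y => |u y| ^ (p - 1)) x :=
    indicator_nonneg fun x _ => by positivity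
  exact div_nonneg (add_nonneg (mul_nonneg (hf _) (hu _)) (mul_nonneg (hf _) (hu _)))
    (by positivity)

theorem measurable_tailTerm (hB : MeasurableSet B) (hu : Measurable u) (hf : Measurable f) :
    Measurable (tailTerm a p B u f) := by
  have : Measurable (Bᶜ.indicator (fun y => |u y| ^ (p - 1))) :=
    Measurable.indicator (by fun_prop) hB.compl
  unfold tailTerm
  fun_prop

theorem lintegral_tailTerm_le (hB : MeasurableSet B) (hu : Measurable u) (hf : Measurable f)
    (hf0 : ∀ x, 0 ≤ f x) {τ : ENNReal}
    (hτ : ∀ x, f x ≠ 0 →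
      ∫⁻ y in Bᶜ, ENNReal.ofReal (|u y| ^ (p - 1) / ‖x - y‖ ^ ((N : ℝ) + a)) ≤ τ) :
    ∫⁻ z, ENNReal.ofReal (tailTerm a p B u f z) ≤ 2 * ((∫⁻ x, ENNReal.ofReal (f x)) * τ) := by
  set v : Eucl N → ℝ := Bᶜ.indicator fun y => |u y| ^ (p - 1) with hv
  have : Measurable v := Measurable.indicator (by fun_prop) hB.compl
  have hv0 : ∀ x, 0 ≤ v x := indicator_nonneg fun x _ => by positivity
  set κ : Eucl N × Eucl N → ENNReal :=
    fun z => ENNReal.ofReal (v z.2 / ‖z.1 - z.2‖ ^ ((N : ℝ) + a)) with hκ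
  have hsplit : ∀ z, ENNReal.ofReal (tailTerm a p B u f z) =
      ENNReal.ofReal (f z.1) * κ z + ENNReal.ofReal (f z.swap.1) * κ z.swap := fun z => by
    rw [hκ, ← ENNReal.ofReal_mul (hf0 _), ← ENNReal.ofReal_mul (hf0 _),
      ← ENNReal.ofReal_add (mul_nonneg (hf0 _) (div_nonneg (hv0 _) (by positivity)))
        (mul_nonneg (hf0 _) (div_nonneg (hv0 _) (by positivity))),
      tailTerm, Prod.fst_swap, Prod.snd_swap, norm_sub_rev z.2, ← mul_div_assoc, ← mul_div_assoc,
      ← add_div]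
  have hslice : ∀ x, ENNReal.ofReal (f x) ≠ 0 → ∫⁻ y, κ (x, y) ≤ τ := fun x hx => by
    refine le_trans (le_of_eq ?_) (hτ x fun h => hx (by simp [h]))
    rw [← lintegral_ofReal_indicator hB.compl]
    refine lintegral_congr fun y => congrArg ENNReal.ofReal ?_
    by_cases hy : y ∈ Bᶜ <;> simp only [hv, hy, indicator_of_mem, indicator_of_notMem,
      not_false_eq_true, zero_div]
  simp only [hsplit]
  rw [Measure.volume_eq_prod, lintegral_add_swap (by fun_prop)]
  gcongr
  exact lintegral_fst_mul_le (by fun_prop) (by fun_prop) hslice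

theorem indicator_diffQuot (z : Eucl N × Eucl N) :
    (B ×ˢ B).indicator (diffQuot a q u) z =
      (B ×ˢ B).indicator (fun z => |u z.1 - u z.2| ^ q) z / ‖z.1 - z.2‖ ^ ((N : ℝ) + a) := by
  by_cases hz : z ∈ B ×ˢ B <;> simp only [hz, indicator_of_mem, indicator_of_notMem,
    not_false_eq_true, zero_div, diffQuot]

theorem indicator_abs_sub_rpow_swap (x y : Eucl N) :
    (B ×ˢ B).indicator (fun z => |u z.1 - u z.2| ^ q) (y, x) =
      (B ×ˢ B).indicator (fun z => |u z.1 - u z.2| ^ q) (x, y) := by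
  by_cases hx : x ∈ B <;> by_cases hy : y ∈ B <;> simp [hx, hy, abs_sub_comm]

theorem abs_sub_rpow_sub_one_mul_le {b c t : ℝ} (hp : 1 < p) (ht : 0 ≤ t) (htb : t ≤ |b|) :
    |b - c| ^ (p - 1) * t ≤ 2 ^ (p - 1) * (|b| ^ p + t * |c| ^ (p - 1)) := by
  calc |b - c| ^ (p - 1) * t
      ≤ 2 ^ (p - 1) * (|b| ^ (p - 1) + |c| ^ (p - 1)) * t := by
        gcongr
        exact (Real.rpow_le_rpow (abs_nonneg _) (abs_sub _ _) (by linarith)).trans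
          (add_rpow_le_two_rpow_mul (by linarith) (abs_nonneg _) (abs_nonneg _))
    _ = 2 ^ (p - 1) * (|b| ^ (p - 1) * t + t * |c| ^ (p - 1)) := by ring
    _ ≤ 2 ^ (p - 1) * (|b| ^ (p - 1) * |b| + t * |c| ^ (p - 1)) := by gcongr
    _ = 2 ^ (p - 1) * (|b| ^ p + t * |c| ^ (p - 1)) := by
        rw [rpow_sub_one_mul_self (by linarith) (abs_nonneg b)]

theorem neg_abs_rpow_mul_excess_le (hp : 1 < p) (hk : 0 ≤ k) (x y : Eucl N) :
    -(excess u k x * |u y| ^ (p - 1)) ≤ |u x - u y| ^ (p - 2) * (u x - u y) * excess u k x := by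
  rcases le_total (u x) k with hx | hx
  · simp [excess, hx]
  · have := mul_le_mul_of_nonneg_right
      (neg_abs_rpow_le_of_nonneg (b := u y) hp (hk.trans hx)) (excess_nonneg u k x)
    linarith

theorem abs_excess_mul_sub_rpow_le_of_abs_sub_le {s t m : ℝ} (hp : 1 < p) (hs : 0 ≤ s)
    (ht : 0 ≤ t) (hst : |s - t| ≤ m) (x y : Eucl N) :
    |excess u k x * s - excess u k y * t| ^ p ≤
      2 ^ p * 4 * (|u x - u y| ^ (p - 2) * (u x - u y) *
        (excess u k x * s ^ p - excess u k y * t ^ p)) +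
      2 ^ p * ((2 * p) ^ p + 1) * 2 ^ p * ((excess u k x ^ p + excess u k y ^ p) * m ^ p) := by
  have hx := excess_nonneg u k x
  have hy := excess_nonneg u k y
  have hsum : ((excess u k x + excess u k y) * |s - t|) ^ p ≤
      2 ^ p * (excess u k x ^ p + excess u k y ^ p) * m ^ p := by
    rw [Real.mul_rpow (by positivity) (abs_nonneg _)]
    gcongr
    exact add_rpow_le_two_rpow_mul (by linarith) hx hy
  have := mul_le_mul_of_nonneg_left hsum (by positivity : 0 ≤ 2 ^ p * ((2 * p) ^ p + 1))
  linarith [abs_excess_mul_sub_rpow_le (u := u) (k := k) (x := x) (y := y) hp hs ht]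

theorem excess_mul_rpow_le {s : ℝ} (hp : 1 < p) (hk : 0 ≤ k) (hs : s ∈ Icc (0 : ℝ) 1)
    (x y : Eucl N) :
    (excess u k x * s) ^ p ≤
      2 ^ p * 4 * (|u x - u y| ^ (p - 2) * (u x - u y) * (excess u k x * s ^ p)) +
        2 ^ p * 4 * (excess u k x ^ p + excess u k x * s ^ p * |u y| ^ (p - 1)) := by
  have hx := excess_nonneg u k x
  have hloc : (excess u k x * s) ^ p ≤ excess u k x ^ p :=
    Real.rpow_le_rpow (mul_nonneg hx hs.1) (mul_le_of_le_one_right hx hs.2) (by linarith)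
  have hform := mul_le_mul_of_nonneg_right
    (neg_abs_rpow_mul_excess_le (u := u) (y := y) hp hk x) (Real.rpow_nonneg hs.1 p)
  have hone : (1 : ℝ) ≤ 2 ^ p := Real.one_le_rpow one_le_two (by linarith)
  have := le_mul_of_one_le_left (Real.rpow_nonneg hx p) (by linarith : 1 ≤ (2 : ℝ) ^ p * 4)
  linarith [mul_le_mul_of_nonneg_left hform (by positivity : (0 : ℝ) ≤ 2 ^ p * 4)]

namespace IsCutoff

theorem diffQuot_excess_mul_le (hψ : IsCutoff B L ψ) (hq : 0 < q) (hk : 0 ≤ k)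
    (z : Eucl N × Eucl N) :
    diffQuot a q (fun x => excess u k x * ψ x) z ≤
      2 ^ q * ((B ×ˢ B).indicator (diffQuot a q u) z +
        localTerm a q L B (fun x => |u x| ^ q) z) := by
  have hB0 : ∀ x, 0 ≤ B.indicator (fun x => |u x| ^ q) x :=
    indicator_nonneg fun x _ => by positivity
  have hBB0 : ∀ z, 0 ≤ (B ×ˢ B).indicator (fun z => |u z.1 - u z.2| ^ q) z :=
    indicator_nonneg fun z _ => by positivity
  have hnum : ∀ x y, |excess u k x * ψ x - excess u k y * ψ y| ^ q ≤
      2 ^ q * ((B ×ˢ B).indicator (fun z => |u z.1 - u z.2| ^ q) (x, y) +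
        (B.indicator (fun x => |u x| ^ q) x + B.indicator (fun x => |u x| ^ q) y) *
          min 1 (L * ‖x - y‖) ^ q) := by
    intro x y
    induction x, y using hψ.pair_induction with
    | symm x y h =>
      rwa [abs_sub_comm, norm_sub_rev, add_comm (B.indicator _ y), indicator_abs_sub_rpow_swap]
    | inside x hx y hy =>
      have := hψ.min_nonneg x y
      simp only [indicator_of_mem, mk_mem_prod, hx, hy]
      calc |excess u k x * ψ x - excess u k y * ψ y| ^ q
          ≤ (|u x - u y| + |u y| * min 1 (L * ‖x - y‖)) ^ q := by
            gcongr
            exact hψ.abs_excess_mul_sub_le hk x y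
        _ ≤ 2 ^ q * (|u x - u y| ^ q + |u y| ^ q * min 1 (L * ‖x - y‖) ^ q) := by
            rw [← Real.mul_rpow (abs_nonneg _) this]
            exact add_rpow_le_two_rpow_mul hq.le (by positivity) (by positivity)
        _ ≤ _ := by gcongr; exact le_add_of_nonneg_left (by positivity)
    | across x hx y hy hψy hm =>
      have hlt : (1 : ℝ) ≤ 2 ^ q := Real.one_le_rpow one_le_two hq.le
      have hxy : (x, y) ∉ B ×ˢ B := fun h => hy h.2
      rw [hψy, hm, indicator_of_notMem hxy, indicator_of_mem hx, indicator_of_notMem hy, mul_zero,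
        sub_zero, zero_add, add_zero, Real.one_rpow, mul_one,
        abs_of_nonneg (hψ.excess_mul_nonneg x)]
      calc (excess u k x * ψ x) ^ q ≤ |u x| ^ q :=
            Real.rpow_le_rpow (hψ.excess_mul_nonneg x) (hψ.excess_mul_le_abs hk x) hq.le
        _ ≤ 2 ^ q * |u x| ^ q := le_mul_of_one_le_left (by positivity) hlt
    | outside x y hx hy =>
      have := hψ.min_nonneg x y
      have := hB0 x
      have := hB0 y
      have := hBB0 (x, y)
      rw [hx, hy, mul_zero, mul_zero, sub_zero, abs_zero, Real.zero_rpow hq.ne']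
      positivity
  refine (div_le_div_of_nonneg_right (hnum z.1 z.2) (by positivity)).trans_eq ?_
  rw [indicator_diffQuot, localTerm, truncKernel]
  ring

theorem diffQuot_one_excess_mul_le (hψ : IsCutoff B L ψ) {Z : Eucl N × Eucl N → ℝ}
    (hZ : Z z ∈ sgnSet (u z.1 - u z.2)) :
    diffQuot a 1 (fun x => excess u k x * ψ x) z ≤
      sgnForm a Z (fun x => excess u k x * ψ x) z + 2 * localTerm a 1 L B (excess u k) z := by
  have hnum : ∀ x y, ∀ ζ ∈ sgnSet (u x - u y),
      |excess u k x * ψ x - excess u k y * ψ y| ≤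
        ζ * (excess u k x * ψ x - excess u k y * ψ y) +
          2 * ((B.indicator (excess u k) x + B.indicator (excess u k) y) *
            min 1 (L * ‖x - y‖)) := by
    intro x y
    induction x, y using hψ.pair_induction with
    | symm x y h =>
      intro ζ hζ
      have := h (-ζ) (by simpa only [neg_sub] using neg_mem_sgnSet hζ)
      rw [abs_sub_comm, norm_sub_rev]
      linarith
    | inside x hx y hy =>
      intro ζ hζ
      have hmul := mul_le_mul_of_nonneg_left (hψ.abs_sub_le x y)
        (add_nonneg (excess_nonneg u k x) (excess_nonneg u k y))
      have hmin := mul_nonneg (add_nonneg (excess_nonneg u k x) (excess_nonneg u k y))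
        (hψ.min_nonneg x y)
      rw [indicator_of_mem hx, indicator_of_mem hy]
      linarith [abs_excess_mul_sub_le_sgn_mul (k := k) hζ (hψ.mem_Icc x).1 (hψ.mem_Icc y).1]
    | across x _ y hy hψy hm =>
      intro ζ hζ
      have hle := hψ.excess_mul_le_indicator (u := u) (k := k) x
      have hmul := mul_le_mul_of_nonneg_right (abs_le.1 (abs_le_one_of_mem_sgnSet hζ)).1
        (hψ.excess_mul_nonneg (u := u) (k := k) x)
      rw [hψy, hm, indicator_of_notMem hy, mul_zero, sub_zero, add_zero, mul_one,
        abs_of_nonneg (hψ.excess_mul_nonneg x)]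
      linarith
    | outside x y hx hy =>
      intro ζ _
      have h0 : ∀ x, 0 ≤ B.indicator (excess u k) x :=
        indicator_nonneg fun x _ => excess_nonneg u k x
      have := mul_nonneg (add_nonneg (h0 x) (h0 y)) (hψ.min_nonneg x y)
      simpa only [hx, hy, mul_zero, sub_zero, abs_zero, zero_add] using
        mul_nonneg zero_le_two this
  rw [diffQuot, Real.rpow_one]
  refine (div_le_div_of_nonneg_right (hnum z.1 z.2 _ hZ) (by positivity)).trans_eq ?_
  rw [sgnForm, localTerm, truncKernel, Real.rpow_one]
  ring

theorem abs_excess_mul_sub_rpow_le (hψ : IsCutoff B L ψ) (hp : 1 < p) (hk : 0 ≤ k)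
    (x y : Eucl N) :
    |excess u k x * ψ x - excess u k y * ψ y| ^ p ≤
      2 ^ p * 4 * (|u x - u y| ^ (p - 2) * (u x - u y) *
        (excess u k x * ψ x ^ p - excess u k y * ψ y ^ p)) +
      2 ^ p * 4 * ((2 * p) ^ p + 1) * 2 ^ p *
        ((B.indicator (fun x => excess u k x ^ p) x + B.indicator (fun x => excess u k x ^ p) y) *
          min 1 (L * ‖x - y‖) ^ p +
        (excess u k x * ψ x ^ p * Bᶜ.indicator (fun y => |u y| ^ (p - 1)) y +
          excess u k y * ψ y ^ p * Bᶜ.indicator (fun y => |u y| ^ (p - 1)) x)) := by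
  set A : ℝ := 2 ^ p * 4 * ((2 * p) ^ p + 1) * 2 ^ p with hA
  have hA1 : (2 : ℝ) ^ p * ((2 * p) ^ p + 1) * 2 ^ p ≤ A := by
    rw [hA]
    gcongr
    exact le_mul_of_one_le_right (by positivity) (by norm_num)
  have hA2 : 2 ^ p * 4 ≤ A :=
    (le_mul_of_one_le_right (by positivity) (le_add_of_nonneg_left (by positivity))).trans
      (le_mul_of_one_le_right (by positivity) (Real.one_le_rpow one_le_two (by linarith)))
  have hp0 : p ≠ 0 := by linarith
  set e : Eucl N → ℝ := excess u k
  have he : ∀ x, 0 ≤ e x := excess_nonneg u k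
  set v : Eucl N → ℝ := Bᶜ.indicator fun y => |u y| ^ (p - 1)
  induction x, y using hψ.pair_induction with
  | symm x y h =>
    rw [abs_sub_comm, norm_sub_rev, abs_sub_comm (u y)]
    linarith
  | inside x hx y hy =>
    have := hψ.min_nonneg x y
    have hvx : v x = 0 := indicator_of_notMem (notMem_compl_iff.2 hx) _
    have hvy : v y = 0 := indicator_of_notMem (notMem_compl_iff.2 hy) _
    rw [indicator_of_mem hx, indicator_of_mem hy, hvx, hvy, mul_zero, mul_zero, add_zero,
      add_zero]
    refine (abs_excess_mul_sub_rpow_le_of_abs_sub_le hp (hψ.mem_Icc x).1 (hψ.mem_Icc y).1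
      (hψ.abs_sub_le x y) x y).trans (add_le_add le_rfl (mul_le_mul_of_nonneg_right hA1 ?_))
    have := he x
    have := he y
    positivity
  | across x hx y hy hψy hm =>
    have hvy : v y = |u y| ^ (p - 1) := indicator_of_mem (mem_compl hy) _
    have hx0 := (hψ.mem_Icc x).1
    have := he x
    rw [hψy, hm, Real.zero_rpow hp0, hvy, indicator_of_mem hx, indicator_of_notMem hy,
      mul_zero, sub_zero, sub_zero, zero_mul, add_zero, add_zero, Real.one_rpow, mul_one,
      abs_of_nonneg (by positivity)]
    exact (excess_mul_rpow_le hp hk (hψ.mem_Icc x) x y).trans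
      (add_le_add le_rfl (mul_le_mul_of_nonneg_right hA2 (by positivity)))
  | outside x y hx hy =>
    have := hψ.min_nonneg x y
    have hind : ∀ x, 0 ≤ B.indicator (fun x => e x ^ p) x :=
      indicator_nonneg fun x _ => Real.rpow_nonneg (he x) p
    have := hind x
    have := hind y
    simp only [hx, hy, mul_zero, sub_zero, zero_mul, abs_zero, Real.zero_rpow hp0, zero_add,
      add_zero]
    positivity

theorem diffQuot_excess_mul_le_powForm (hψ : IsCutoff B L ψ) (hp : 1 < p) (hk : 0 ≤ k)
    (z : Eucl N × Eucl N) :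
    diffQuot a p (fun x => excess u k x * ψ x) z ≤
      2 ^ p * 4 * powForm a p u (fun x => excess u k x * ψ x ^ p) z +
        2 ^ p * 4 * ((2 * p) ^ p + 1) * 2 ^ p *
          (localTerm a p L B (fun x => excess u k x ^ p) z +
            tailTerm a p B u (fun x => excess u k x * ψ x ^ p) z) := by
  refine (div_le_div_of_nonneg_right (hψ.abs_excess_mul_sub_rpow_le hp hk z.1 z.2)
    (by positivity)).trans_eq ?_
  rw [powForm, localTerm, truncKernel, tailTerm]
  ring

theorem abs_powForm_excess_mul_le (hψ : IsCutoff B L ψ) (hp : 1 < p) (hk : 0 ≤ k)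
    (z : Eucl N × Eucl N) :
    |powForm a p u (fun x => excess u k x * ψ x) z| ≤
      (B ×ˢ B).indicator (diffQuot a p u) z + diffQuot a p (fun x => excess u k x * ψ x) z +
        2 ^ (p - 1) * (localTerm a p L B (fun x => |u x| ^ p) z +
          tailTerm a p B u (fun x => excess u k x * ψ x) z) := by
  set v : Eucl N → ℝ := Bᶜ.indicator fun y => |u y| ^ (p - 1)
  set φ : Eucl N → ℝ := fun x => excess u k x * ψ x with hφ
  have hφ0 : ∀ x, 0 ≤ φ x := hψ.excess_mul_nonneg
  have hv0 : ∀ x, 0 ≤ v x := indicator_nonneg fun x _ => by positivity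
  have hu0 : ∀ x, 0 ≤ B.indicator (fun x => |u x| ^ p) x :=
    indicator_nonneg fun x _ => by positivity
  have hBB0 : ∀ z, 0 ≤ (B ×ˢ B).indicator (fun z => |u z.1 - u z.2| ^ p) z :=
    indicator_nonneg fun z _ => by positivity
  have hnum : ∀ x y, |u x - u y| ^ (p - 1) * |φ x - φ y| ≤
      (B ×ˢ B).indicator (fun z => |u z.1 - u z.2| ^ p) (x, y) + |φ x - φ y| ^ p +
        2 ^ (p - 1) * ((B.indicator (fun x => |u x| ^ p) x + B.indicator (fun x => |u x| ^ p) y) *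
          min 1 (L * ‖x - y‖) ^ p + (φ x * v y + φ y * v x)) := by
    intro x y
    induction x, y using hψ.pair_induction with
    | symm x y h =>
      rw [indicator_abs_sub_rpow_swap, abs_sub_comm (φ y), norm_sub_rev, abs_sub_comm (u y)]
      linarith
    | inside x hx y hy =>
      have := hψ.min_nonneg x y
      have := hφ0 x
      have := hφ0 y
      have := hv0 x
      have := hv0 y
      have := hu0 x
      have := hu0 y
      have hyoung := rpow_sub_one_mul_le_add (c := 1) hp.le one_pos
        (abs_nonneg (u x - u y)) (abs_nonneg (φ x - φ y))
      rw [div_one, Real.one_rpow, one_mul] at hyoung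
      rw [indicator_of_mem (mk_mem_prod hx hy)]
      exact hyoung.trans (le_add_of_nonneg_right (by positivity))
    | across x hx y hy hψy hm =>
      have hvy : v y = |u y| ^ (p - 1) := indicator_of_mem (mem_compl hy) _
      have hφy : φ y = 0 := by simp only [hφ, hψy, mul_zero]
      have := abs_sub_rpow_sub_one_mul_le (c := u y) hp (hφ0 x) (hψ.excess_mul_le_abs hk x)
      have := Real.rpow_nonneg (hφ0 x) p
      rw [hm, hvy, hφy, indicator_of_mem hx, indicator_of_notMem hy, Real.one_rpow, sub_zero,
        zero_mul, abs_of_nonneg (hφ0 x)]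
      linarith [hBB0 (x, y)]
    | outside x y hx hy =>
      have := hψ.min_nonneg x y
      have := hu0 x
      have := hu0 y
      have := hBB0 (x, y)
      simp only [hφ, hx, hy, mul_zero, sub_zero, zero_mul, abs_zero, add_zero]
      positivity
  rw [powForm, abs_div, abs_mul, abs_abs_rpow_sub_two_mul_self hp,
    abs_of_nonneg (by positivity : 0 ≤ ‖z.1 - z.2‖ ^ ((N : ℝ) + a))]
  refine (div_le_div_of_nonneg_right (hnum z.1 z.2) (by positivity)).trans_eq ?_
  rw [indicator_diffQuot, diffQuot, localTerm, truncKernel, tailTerm]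
  ring

end IsCutoff

end PairTerms

section Caccioppoli

variable {N : ℕ} {p s₁ sp γ q k L τ : ℝ} {B Ω : Set (Eucl N)} {u f ψ : Eucl N → ℝ}

theorem integrable_diffQuot (hf : Measurable f) (h : gagliardo γ q univ f < ⊤) :
    Integrable (diffQuot (γ * q) q f) := by
  rw [gagliardo_univ] at h
  exact (lintegral_ofReal_ne_top_iff_integrable (by fun_prop)
    (ae_of_all _ fun z => diffQuot_nonneg z)).1 h.ne

theorem integrable_indicator_diffQuot (hB : MeasurableSet B) (hu : Measurable u)
    (h : gagliardo γ q B u < ⊤) : Integrable ((B ×ˢ B).indicator (diffQuot (γ * q) q u)) := by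
  rw [← lintegral_indicator_diffQuot hB] at h
  exact (lintegral_ofReal_ne_top_iff_integrable
    ((measurable_diffQuot hu).indicator (hB.prod hB)).aestronglyMeasurable
    (ae_of_all _ (indicator_nonneg fun z _ => diffQuot_nonneg z))).1 h.ne

theorem MemFracSobolev.integrable_localTerm [NeZero N] (hγ : γ ∈ Ioo (0 : ℝ) 1) (hq : 0 < q)
    (hB : MeasurableSet B) (hu : Measurable u) (h : MemFracSobolev γ q B u) (hL : 0 < L) :
    Integrable (localTerm (γ * q) q L B fun x => |u x| ^ q) := by
  obtain ⟨C, -, hC⟩ := exists_lintegral_localTerm_le (N := N) (mul_pos hγ.1 hq)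
    (mul_lt_of_lt_one_left hq hγ.2)
  have hfin := (hC L hL hB (g := fun x => |u x| ^ q) (by fun_prop) fun x => by positivity).trans_lt
    (ENNReal.mul_lt_top ENNReal.ofReal_lt_top (h.lintegral_rpow_lt_top hq))
  exact (lintegral_ofReal_ne_top_iff_integrable
    (measurable_localTerm hB (by fun_prop)).aestronglyMeasurable
    (ae_of_all _ (localTerm_nonneg hL.le fun x => by positivity))).1 hfin.ne

theorem MemFracSobolev.excess_mul_cutoff [NeZero N] (hγ : γ ∈ Ioo (0 : ℝ) 1) (hq : 1 ≤ q)
    (hB : MeasurableSet B) (hu : Measurable u) (h : MemFracSobolev γ q B u) (hk : 0 ≤ k)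
    (hL : 0 < L) (hψ : IsCutoff B L ψ) :
    MemFracSobolev γ q univ (fun x => excess u k x * ψ x) := by
  have : Measurable ψ := hψ.continuous.measurable
  refine ⟨?_, ?_⟩
  · rw [Measure.restrict_univ]
    refine ((memLp_indicator_iff_restrict hB).2 h.1).mono (by fun_prop) (ae_of_all _ fun x => ?_)
    by_cases hx : x ∈ B
    · rw [indicator_of_mem hx, Real.norm_of_nonneg (hψ.excess_mul_nonneg x)]
      exact hψ.excess_mul_le_abs hk x
    · simp [hx, hψ.eq_zero hx]
  · have hq0 : 0 < q := by linarith
    have hint := ((integrable_indicator_diffQuot hB hu h.2).add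
      (h.integrable_localTerm hγ hq0 hB hu hL)).const_mul (2 ^ q)
    rw [gagliardo_univ]
    exact (lintegral_mono fun z => ENNReal.ofReal_le_ofReal
      (hψ.diffQuot_excess_mul_le hq0 hk z)).trans_lt hint.lintegral_lt_top

theorem IsCutoff.lintegral_excess_mul_le (hψ : IsCutoff B L ψ) (hB : MeasurableSet B) :
    ∫⁻ x, ENNReal.ofReal (excess u k x * ψ x) ≤ ∫⁻ x in B, ENNReal.ofReal (excess u k x) := by
  rw [← lintegral_ofReal_indicator hB]
  exact lintegral_mono fun x => ENNReal.ofReal_le_ofReal (hψ.excess_mul_le_indicator x)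

theorem IsCutoff.lintegral_tailTerm_excess_mul_le {a : ℝ} (hψ : IsCutoff B L ψ)
    (hB : MeasurableSet B) (hu : Measurable u) (hτ : ∀ x, ψ x ≠ 0 →
      ∫⁻ y in Bᶜ, ENNReal.ofReal (|u y| ^ (p - 1) / ‖x - y‖ ^ ((N : ℝ) + a)) ≤ ENNReal.ofReal τ) :
    ∫⁻ z, ENNReal.ofReal (tailTerm a p B u (fun x => excess u k x * ψ x) z) ≤
      ENNReal.ofReal (2 * τ) * ∫⁻ x in B, ENNReal.ofReal (excess u k x) := by
  have : Measurable ψ := hψ.continuous.measurable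
  calc _ ≤ 2 * ((∫⁻ x, ENNReal.ofReal (excess u k x * ψ x)) * ENNReal.ofReal τ) :=
        lintegral_tailTerm_le hB hu (by fun_prop) hψ.excess_mul_nonneg
          fun x hx => hτ x (right_ne_zero_of_mul hx)
    _ ≤ 2 * ((∫⁻ x in B, ENNReal.ofReal (excess u k x)) * ENNReal.ofReal τ) := by
        exact mul_le_mul' le_rfl (mul_le_mul' (hψ.lintegral_excess_mul_le hB) le_rfl)
    _ = _ := by
        rw [ENNReal.ofReal_mul zero_le_two, ENNReal.ofReal_ofNat]
        ring

theorem integrable_sgnForm {Z : Eucl N × Eucl N → ℝ} (hf : Measurable f)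
    (hfin : gagliardo s₁ 1 univ f < ⊤) (hZm : AEStronglyMeasurable Z) (hZ : ∀ᵐ z, |Z z| ≤ 1) :
    Integrable (sgnForm s₁ Z f) := by
  have hint := integrable_diffQuot hf hfin
  rw [mul_one] at hint
  have : Measurable fun z : Eucl N × Eucl N => f z.1 - f z.2 := by fun_prop
  have : Measurable fun z : Eucl N × Eucl N => ‖z.1 - z.2‖ ^ ((N : ℝ) + s₁) := by fun_prop
  have := hZm.aemeasurable
  refine hint.mono' (AEMeasurable.aestronglyMeasurable (by unfold sgnForm; fun_prop)) ?_
  filter_upwards [hZ] with z hz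
  rw [sgnForm, diffQuot, Real.rpow_one, Real.norm_eq_abs, abs_div, abs_mul,
    abs_of_nonneg (by positivity : 0 ≤ ‖z.1 - z.2‖ ^ ((N : ℝ) + s₁))]
  gcongr
  exact mul_le_of_le_one_left (abs_nonneg _) hz

theorem integrable_powForm [NeZero N] (hp : 1 < p) (hsp : sp ∈ Ioo (0 : ℝ) 1)
    (hB : MeasurableSet B) (hu : Measurable u) (hu1 : MemFracSobolev s₁ 1 B u)
    (hup : MemFracSobolev sp p B u) (hk : 0 ≤ k) (hL : 0 < L) (hψ : IsCutoff B L ψ)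
    (hτ : ∀ x, ψ x ≠ 0 →
      ∫⁻ y in Bᶜ, ENNReal.ofReal (|u y| ^ (p - 1) / ‖x - y‖ ^ ((N : ℝ) + sp * p)) ≤
        ENNReal.ofReal τ) :
    Integrable (powForm (sp * p) p u fun x => excess u k x * ψ x) := by
  have : Measurable ψ := hψ.continuous.measurable
  have hexcess : ∫⁻ x in B, ENNReal.ofReal (excess u k x) < ⊤ := by
    refine (lintegral_mono fun x => ENNReal.ofReal_le_ofReal ?_).trans_lt
      (hu1.lintegral_rpow_lt_top one_pos)
    rw [Real.rpow_one]
    exact excess_le_abs hk x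
  have htail : Integrable (tailTerm (sp * p) p B u fun x => excess u k x * ψ x) :=
    (lintegral_ofReal_ne_top_iff_integrable
      (measurable_tailTerm hB hu (by fun_prop)).aestronglyMeasurable
      (ae_of_all _ (tailTerm_nonneg hψ.excess_mul_nonneg))).1
      ((hψ.lintegral_tailTerm_excess_mul_le hB hu hτ).trans_lt
        (ENNReal.mul_lt_top ENNReal.ofReal_lt_top hexcess)).ne
  have hquot := integrable_diffQuot (by fun_prop)
    (hup.excess_mul_cutoff hsp hp.le hB hu hk hL hψ).2
  have hbound := ((integrable_indicator_diffQuot hB hu hup.2).add hquot).add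
    (((hup.integrable_localTerm hsp (by linarith) hB hu hL).add htail).const_mul (2 ^ (p - 1)))
  refine hbound.mono' (Measurable.aestronglyMeasurable (by unfold powForm; fun_prop))
    (ae_of_all _ fun z => hψ.abs_powForm_excess_mul_le hp hk z)

theorem IsWeakSolution.exists_integral_eq_zero [NeZero N] (hp : 1 < p)
    (hs₁ : s₁ ∈ Ioo (0 : ℝ) 1) (hsp : sp ∈ Ioo (0 : ℝ) 1) (hu : Measurable u)
    (hsol : IsWeakSolution p s₁ sp Ω u) (hBo : IsOpen B) (hBc : IsCompact (closure B))
    (hBΩ : closure B ⊆ Ω) (hk : 0 ≤ k) (hL : 0 < L) (hψ : IsCutoff B L ψ)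
    (hτ : ∀ x, ψ x ≠ 0 →
      ∫⁻ y in Bᶜ, ENNReal.ofReal (|u y| ^ (p - 1) / ‖x - y‖ ^ ((N : ℝ) + sp * p)) ≤
        ENNReal.ofReal τ) :
    ∃ Z : Eucl N × Eucl N → ℝ, (∀ᵐ z, Z z ∈ sgnSet (u z.1 - u z.2)) ∧
      Integrable (fun z => sgnForm s₁ Z (fun x => excess u k x * ψ x) z +
        powForm (sp * p) p u (fun x => excess u k x * ψ x) z) ∧
      ∫ z, (sgnForm s₁ Z (fun x => excess u k x * ψ x) z +
        powForm (sp * p) p u (fun x => excess u k x * ψ x) z) = 0 := by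
  obtain ⟨hu1, hup, -, Z, hZm, hZs, heq⟩ := hsol
  replace hu1 := hu1 B hBo hBc hBΩ
  replace hup := hup B hBo hBc hBΩ
  have hB := hBo.measurableSet
  have : Measurable ψ := hψ.continuous.measurable
  have hφ1 := hu1.excess_mul_cutoff hs₁ le_rfl hB hu hk hL hψ
  have hφp := hup.excess_mul_cutoff hsp hp.le hB hu hk hL hψ
  have hsupp : tsupport (fun x => excess u k x * ψ x) ⊆ closure B :=
    closure_mono fun x hx => of_not_not fun h => hx (by simp [hψ.eq_zero h])
  have hsgn := integrable_sgnForm (by fun_prop) hφ1.2 hZm.1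
    (hZs.mono fun z hz => abs_le_one_of_mem_sgnSet hz)
  have hpow := integrable_powForm hp hsp hB hu hu1 hup hk hL hψ hτ
  refine ⟨Z, hZs, hsgn.add hpow, ?_⟩
  rw [integral_add hsgn hpow]
  exact heq _ hφ1 hφp (hBc.of_isClosed_subset (isClosed_tsupport _) hsupp) (hsupp.trans hBΩ)

theorem gagliardo_one_add_gagliardo {g : Eucl N → ℝ} (hf : Measurable f) :
    gagliardo s₁ 1 univ f + gagliardo sp p univ g =
      ∫⁻ z, ENNReal.ofReal (diffQuot s₁ 1 f z + diffQuot (sp * p) p g z) := by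
  rw [gagliardo_univ_one, gagliardo_univ, ← lintegral_add_left (by fun_prop)]
  exact lintegral_congr fun z => (ENNReal.ofReal_add (diffQuot_nonneg z) (diffQuot_nonneg z)).symm

/-- The error terms of the Caccioppoli inequality. -/
noncomputable def caccioppoliError (p s₁ sp k L : ℝ) (B : Set (Eucl N)) (u ψ : Eucl N → ℝ)
    (z : Eucl N × Eucl N) : ℝ :=
  localTerm s₁ 1 (p * L) B (excess u k) z +
    localTerm (sp * p) p L B (fun x => excess u k x ^ p) z +
    tailTerm (sp * p) p B u (fun x => excess u k x * ψ x ^ p) z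

theorem IsCutoff.diffQuot_add_diffQuot_le {Z : Eucl N × Eucl N → ℝ} {z : Eucl N × Eucl N}
    (hψ : IsCutoff B L ψ) (hp : 1 < p) (hk : 0 ≤ k) (hL : 0 ≤ L)
    (hZ : Z z ∈ sgnSet (u z.1 - u z.2)) :
    diffQuot s₁ 1 (fun x => excess u k x * ψ x ^ p) z +
        diffQuot (sp * p) p (fun x => excess u k x * ψ x) z ≤
      2 ^ p * 4 * (sgnForm s₁ Z (fun x => excess u k x * ψ x ^ p) z +
        powForm (sp * p) p u (fun x => excess u k x * ψ x ^ p) z) +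
      2 ^ p * 4 * ((2 * p) ^ p + 1) * 2 ^ p * caccioppoliError p s₁ sp k L B u ψ z := by
  have hsgn := (hψ.rpow hp.le).diffQuot_one_excess_mul_le (a := s₁) (k := k) hZ
  have hpow := hψ.diffQuot_excess_mul_le_powForm (u := u) (a := sp * p) hp hk z
  have hone : (1 : ℝ) ≤ 2 ^ p * 4 := by
    linarith [Real.one_le_rpow one_le_two (by linarith : 0 ≤ p)]
  have htwo : (2 : ℝ) ≤ ((2 * p) ^ p + 1) * 2 ^ p := by
    calc (2 : ℝ) = 1 * 2 ^ (1 : ℝ) := by norm_num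
      _ ≤ ((2 * p) ^ p + 1) * 2 ^ p := by
        gcongr
        · exact le_add_of_nonneg_left (by positivity)
        · exact one_le_two
  have hloc := mul_le_mul_of_nonneg_left (mul_le_mul_of_nonneg_right htwo
    (localTerm_nonneg (a := s₁) (q := 1) (B := B) (mul_nonneg (by linarith : 0 ≤ p) hL)
      (excess_nonneg u k) z)) (by positivity : (0 : ℝ) ≤ 2 ^ p * 4)
  have hscaled := le_mul_of_one_le_left ((diffQuot_nonneg z).trans hsgn) hone
  rw [caccioppoliError]
  linarith

theorem caccioppoliError_nonneg (hp : 0 ≤ p) (hL : 0 ≤ L) (hψ : IsCutoff B L ψ)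
    (z : Eucl N × Eucl N) : 0 ≤ caccioppoliError p s₁ sp k L B u ψ z :=
  add_nonneg (add_nonneg (localTerm_nonneg (mul_nonneg hp hL) (excess_nonneg u k) z)
    (localTerm_nonneg hL (fun x => Real.rpow_nonneg (excess_nonneg u k x) p) z))
    (tailTerm_nonneg (fun x => mul_nonneg (excess_nonneg u k x)
      (Real.rpow_nonneg (hψ.mem_Icc x).1 p)) z)

theorem measurable_caccioppoliError (hB : MeasurableSet B) (hu : Measurable u)
    (hψ : IsCutoff B L ψ) : Measurable (caccioppoliError p s₁ sp k L B u ψ) := by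
  have : Measurable ψ := hψ.continuous.measurable
  exact ((measurable_localTerm hB (by fun_prop)).add (measurable_localTerm hB (by fun_prop))).add
    (measurable_tailTerm hB hu (by fun_prop))

theorem exists_lintegral_caccioppoliError_le [NeZero N] (hp : 1 < p) (hs₁ : s₁ ∈ Ioo (0 : ℝ) 1)
    (hsp : sp ∈ Ioo (0 : ℝ) 1) :
    ∃ C > 0, ∀ {B : Set (Eucl N)} {L : ℝ} {u ψ : Eucl N → ℝ} {k τ : ℝ}, MeasurableSet B → 0 < L →
      Measurable u → IsCutoff B L ψ → 0 ≤ τ →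
      (∀ x, ψ x ≠ 0 → ∫⁻ y in Bᶜ, ENNReal.ofReal
        (|u y| ^ (p - 1) / ‖x - y‖ ^ ((N : ℝ) + sp * p)) ≤ ENNReal.ofReal τ) →
      ∫⁻ z, ENNReal.ofReal (caccioppoliError p s₁ sp k L B u ψ z) ≤
        ENNReal.ofReal (C * (L ^ s₁ + τ)) * (∫⁻ x in B, ENNReal.ofReal (excess u k x)) +
          ENNReal.ofReal (C * L ^ (sp * p)) * ∫⁻ x in B, ENNReal.ofReal (excess u k x ^ p) := by
  have hp0 : 0 < p := by linarith
  obtain ⟨C₁, hC₁, h₁⟩ := exists_lintegral_localTerm_le (N := N) (q := 1) hs₁.1 hs₁.2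
  obtain ⟨C₂, hC₂, h₂⟩ := exists_lintegral_localTerm_le (N := N) (mul_pos hsp.1 hp0)
    (mul_lt_of_lt_one_left hp0 hsp.2)
  refine ⟨C₁ * p ^ s₁ + C₂ + 2, by positivity, fun {B L u ψ k τ} hB hL hu hψ hτ0 hτ => ?_⟩
  have hloc₁ := h₁ (p * L) (by positivity) hB (g := excess u k) (by fun_prop) (excess_nonneg u k)
  have hlocp := h₂ L hL hB (g := fun x => excess u k x ^ p) (by fun_prop)
    fun x => Real.rpow_nonneg (excess_nonneg u k x) p
  have htail := (hψ.rpow hp.le).lintegral_tailTerm_excess_mul_le (k := k) hB hu fun x hx =>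
    hτ x fun h => hx (by simp only [h, Real.zero_rpow hp0.ne'])
  have : Measurable (localTerm s₁ 1 (p * L) B (excess u k)) :=
    measurable_localTerm hB (by fun_prop)
  have : Measurable (localTerm (sp * p) p L B fun x => excess u k x ^ p) :=
    measurable_localTerm hB (by fun_prop)
  calc ∫⁻ z, ENNReal.ofReal (caccioppoliError p s₁ sp k L B u ψ z)
      ≤ ∫⁻ z, (ENNReal.ofReal (localTerm s₁ 1 (p * L) B (excess u k) z) +
          ENNReal.ofReal (localTerm (sp * p) p L B (fun x => excess u k x ^ p) z) +
          ENNReal.ofReal (tailTerm (sp * p) p B u (fun x => excess u k x * ψ x ^ p) z)) :=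
        lintegral_mono fun z => ENNReal.ofReal_add_le.trans (by gcongr; exact ENNReal.ofReal_add_le)
    _ ≤ ENNReal.ofReal (C₁ * (p * L) ^ s₁) * (∫⁻ x in B, ENNReal.ofReal (excess u k x)) +
          ENNReal.ofReal (C₂ * L ^ (sp * p)) * (∫⁻ x in B, ENNReal.ofReal (excess u k x ^ p)) +
          ENNReal.ofReal (2 * τ) * ∫⁻ x in B, ENNReal.ofReal (excess u k x) := by
        rw [lintegral_add_left (by fun_prop), lintegral_add_left (by fun_prop)]
        exact add_le_add (add_le_add hloc₁ hlocp) htail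
    _ = ENNReal.ofReal (C₁ * (p * L) ^ s₁ + 2 * τ) * (∫⁻ x in B, ENNReal.ofReal (excess u k x)) +
          ENNReal.ofReal (C₂ * L ^ (sp * p)) * ∫⁻ x in B, ENNReal.ofReal (excess u k x ^ p) := by
        rw [ENNReal.ofReal_add (by positivity) (by positivity)]
        ring
    _ ≤ _ := by
        have : 0 ≤ L ^ s₁ := by positivity
        have : 0 ≤ p ^ s₁ := by positivity
        refine add_le_add (mul_le_mul' (ENNReal.ofReal_le_ofReal ?_) le_rfl)
          (mul_le_mul' (ENNReal.ofReal_le_ofReal ?_) le_rfl)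
        · rw [Real.mul_rpow hp0.le hL.le]
          have : 0 ≤ C₁ * p ^ s₁ * τ + C₂ * τ + (C₂ + 2) * L ^ s₁ := by positivity
          linarith
        · gcongr
          linarith [mul_nonneg hC₁.le this]

theorem exists_caccioppoli [NeZero N] (hp : 1 < p) (hs₁ : s₁ ∈ Ioo (0 : ℝ) 1)
    (hsp : sp ∈ Ioo (0 : ℝ) 1) :
    ∃ C > 0, ∀ {Ω B : Set (Eucl N)} {u ψ : Eucl N → ℝ} {k L τ : ℝ}, Measurable u →
      IsWeakSolution p s₁ sp Ω u → IsOpen B → IsCompact (closure B) → closure B ⊆ Ω → 0 ≤ k →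
      0 < L → IsCutoff B L ψ → 0 ≤ τ →
      (∀ x, ψ x ≠ 0 → ∫⁻ y in Bᶜ, ENNReal.ofReal
        (|u y| ^ (p - 1) / ‖x - y‖ ^ ((N : ℝ) + sp * p)) ≤ ENNReal.ofReal τ) →
      gagliardo s₁ 1 univ (fun x => excess u k x * ψ x ^ p) +
          gagliardo sp p univ (fun x => excess u k x * ψ x) ≤
        ENNReal.ofReal (C * (L ^ s₁ + τ)) * (∫⁻ x in B, ENNReal.ofReal (excess u k x)) +
          ENNReal.ofReal (C * L ^ (sp * p)) * ∫⁻ x in B, ENNReal.ofReal (excess u k x ^ p) := by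
  have hp0 : 0 < p := by linarith
  obtain ⟨C, hC, herror⟩ := exists_lintegral_caccioppoliError_le (N := N) hp hs₁ hsp
  set K : ℝ := 2 ^ p * 4 * ((2 * p) ^ p + 1) * 2 ^ p
  have hK0 : 0 < K := by positivity
  refine ⟨K * C, by positivity, fun {Ω B u ψ k L τ} hu hsol hBo hBc hBΩ hk hL hψ hτ0 hτ => ?_⟩
  have : Measurable ψ := hψ.continuous.measurable
  have hB := hBo.measurableSet
  obtain ⟨Z, hZ, hint, hzero⟩ := hsol.exists_integral_eq_zero hp hs₁ hsp hu hBo hBc hBΩ hk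
    (by positivity) (hψ.rpow hp.le) fun x hx =>
      hτ x fun h => hx (by simp only [h, Real.zero_rpow hp0.ne'])
  have herr0 := fun z => caccioppoliError_nonneg (s₁ := s₁) (sp := sp) (k := k) (u := u)
    hp0.le hL.le hψ z
  rw [gagliardo_one_add_gagliardo (by fun_prop)]
  calc _ ≤ ∫⁻ z, ENNReal.ofReal (K * caccioppoliError p s₁ sp k L B u ψ z) :=
        lintegral_le_of_integral_eq_zero (hint.const_mul (2 ^ p * 4))
          (by rw [integral_const_mul, hzero, mul_zero])
          ((measurable_caccioppoliError hB hu hψ).const_mul K).aestronglyMeasurable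
          (fun z => mul_nonneg hK0.le (herr0 z))
          (fun z => add_nonneg (diffQuot_nonneg z) (diffQuot_nonneg z))
          (hZ.mono fun z hz => hψ.diffQuot_add_diffQuot_le hp hk hL.le hz)
    _ = ENNReal.ofReal K * ∫⁻ z, ENNReal.ofReal (caccioppoliError p s₁ sp k L B u ψ z) := by
        simp only [ENNReal.ofReal_mul hK0.le]
        exact lintegral_const_mul' _ _ ENNReal.ofReal_ne_top
    _ ≤ _ := by
        refine (mul_le_mul' le_rfl (herror hB hL hu hψ hτ0 hτ)).trans_eq ?_
        rw [mul_add, ← mul_assoc, ← mul_assoc, ← ENNReal.ofReal_mul hK0.le,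
          ← ENNReal.ofReal_mul hK0.le, ← mul_assoc, ← mul_assoc]

end Caccioppoli

section Growth

variable {p s₁ sp r c s t : ℝ}

theorem bigH_eq_mul_smallH (hp : p ≠ 0) (ht : 0 ≤ t) :
    bigH p s₁ sp r t = t * smallH p s₁ sp r t := by
  rw [bigH, smallH, ← rpow_sub_one_mul_self hp ht]
  ring

theorem bigH_nonneg (hr : 0 < r) (ht : 0 ≤ t) : 0 ≤ bigH p s₁ sp r t := by
  unfold bigH; positivity

theorem bigH_pos (hr : 0 < r) (ht : 0 < t) : 0 < bigH p s₁ sp r t := by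
  unfold bigH; positivity

theorem bigH_mono (hp : 0 ≤ p) (hr : 0 < r) (hs : 0 ≤ s) (hst : s ≤ t) :
    bigH p s₁ sp r s ≤ bigH p s₁ sp r t := by
  unfold bigH
  gcongr

theorem smallH_mono (hp : 1 ≤ p) (hr : 0 < r) (hs : 0 ≤ s) (hst : s ≤ t) :
    smallH p s₁ sp r s ≤ smallH p s₁ sp r t := by
  unfold smallH
  gcongr

theorem smallH_nonneg (hr : 0 < r) (ht : 0 ≤ t) : 0 ≤ smallH p s₁ sp r t := by
  unfold smallH; positivity

theorem smallH_mul_le (hp : 1 ≤ p) (hr : 0 < r) (hc : 1 ≤ c) (ht : 0 ≤ t) :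
    smallH p s₁ sp r (c * t) ≤ c ^ (p - 1) * smallH p s₁ sp r t := by
  have hone : 1 ≤ c ^ (p - 1) := Real.one_le_rpow hc (by linarith)
  rw [smallH, smallH, Real.mul_rpow (by linarith) ht, mul_add, mul_div_assoc]
  gcongr
  exact le_mul_of_one_le_left (by positivity) hone

theorem bigH_mul_le (hp : 1 ≤ p) (hr : 0 < r) (hc : 1 ≤ c) (ht : 0 ≤ t) :
    bigH p s₁ sp r (c * t) ≤ c ^ p * bigH p s₁ sp r t := by
  have hc0 : 0 ≤ c := by linarith
  have hp0 : p ≠ 0 := by linarith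
  calc bigH p s₁ sp r (c * t) = c * t * smallH p s₁ sp r (c * t) :=
        bigH_eq_mul_smallH hp0 (mul_nonneg hc0 ht)
    _ ≤ c * t * (c ^ (p - 1) * smallH p s₁ sp r t) := by
        gcongr
        exact smallH_mul_le hp hr hc ht
    _ = c ^ p * bigH p s₁ sp r t := by
        rw [bigH_eq_mul_smallH hp0 ht, ← rpow_sub_one_mul_self hp0 hc0]
        ring

theorem mul_bigH_le (hp : 1 ≤ p) (hr : 0 < r) (hc : 1 ≤ c) (ht : 0 ≤ t) :
    c * bigH p s₁ sp r t ≤ bigH p s₁ sp r (c * t) := by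
  have hct : t ≤ c * t := le_mul_of_one_le_left ht hc
  rw [bigH_eq_mul_smallH (by linarith) (ht.trans hct), bigH_eq_mul_smallH (by linarith) ht,
    ← mul_assoc]
  exact mul_le_mul_of_nonneg_left (smallH_mono hp hr ht hct) (ht.trans hct)

@[fun_prop]
theorem measurable_bigH : Measurable (bigH p s₁ sp r) := by
  unfold bigH
  fun_prop

end Growth

section Ball

variable {N : ℕ} {x₀ : Eucl N}

theorem abs_max_min_sub_max_min_le (a b : ℝ) :
    |max 0 (min 1 a) - max 0 (min 1 b)| ≤ min 1 |a - b| := by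
  have hmem : ∀ c : ℝ, 0 ≤ max 0 (min 1 c) ∧ max 0 (min 1 c) ≤ 1 :=
    fun c => ⟨le_max_left _ _, max_le zero_le_one (min_le_left _ _)⟩
  refine le_min (abs_sub_le_of_nonneg_of_le (hmem a).1 (hmem a).2 (hmem b).1 (hmem b).2) ?_
  calc |max 0 (min 1 a) - max 0 (min 1 b)| ≤ |min 1 a - min 1 b| := by
        simpa using abs_max_sub_max_le_max 0 (min 1 a) 0 (min 1 b)
    _ ≤ |a - b| := by simpa using abs_min_sub_min_le_max 1 a 1 b

theorem exists_isCutoff_ball (x₀ : Eucl N) {ρ' ρ : ℝ} (hρ : ρ' < ρ) :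
    ∃ ψ : Eucl N → ℝ, IsCutoff (Metric.ball x₀ ρ) (2 / (ρ - ρ')) ψ ∧
      ∀ x ∈ Metric.ball x₀ ρ', ψ x = 1 := by
  set L : ℝ := 2 / (ρ - ρ')
  have hL : 0 < L := div_pos two_pos (sub_pos.2 hρ)
  have hLd : L * (ρ - ρ') = 2 := div_mul_cancel₀ _ (sub_pos.2 hρ).ne'
  refine ⟨fun x => max 0 (min 1 (1 - L * (‖x - x₀‖ - ρ'))), ⟨fun x => ?_, fun x y => ?_,
    fun x y hx hy => ?_⟩, fun x hx => ?_⟩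
  · exact ⟨le_max_left _ _, max_le zero_le_one (min_le_left _ _)⟩
  · refine (abs_max_min_sub_max_min_le _ _).trans (min_le_min le_rfl ?_)
    rw [show 1 - L * (‖x - x₀‖ - ρ') - (1 - L * (‖y - x₀‖ - ρ')) =
      L * (‖y - x₀‖ - ‖x - x₀‖) by ring, abs_mul, abs_of_pos hL, abs_sub_comm]
    gcongr
    simpa only [sub_sub_sub_cancel_right] using abs_norm_sub_norm_le (x - x₀) (y - x₀)
  · have hx' : 0 < 1 - L * (‖x - x₀‖ - ρ') := by
      by_contra! h
      exact hx (max_eq_left ((min_le_right _ _).trans h))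
    have hy' : ρ ≤ ‖y - x₀‖ := by simpa [dist_eq_norm] using hy
    have htri : ‖y - x₀‖ ≤ ‖x - y‖ + ‖x - x₀‖ := by
      simpa only [norm_sub_rev y x] using norm_sub_le_norm_sub_add_norm_sub y x x₀
    linarith [mul_le_mul_of_nonneg_left (hy'.trans htri) hL.le]
  · have hx' : ‖x - x₀‖ < ρ' := by simpa [dist_eq_norm] using hx
    have := mul_nonneg hL.le (sub_nonneg.2 hx'.le)
    have hone : 1 ≤ 1 - L * (‖x - x₀‖ - ρ') := by linarith
    simp only [min_eq_left hone, max_eq_right zero_le_one]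

theorem IsCutoff.norm_sub_center_le {ρ r L : ℝ} {ψ : Eucl N → ℝ}
    (hψ : IsCutoff (Metric.ball x₀ ρ) L ψ) (hr : 0 ≤ r) (hρr : ρ ≤ r) {x y : Eucl N}
    (hx : ψ x ≠ 0) (hy : y ∉ Metric.ball x₀ ρ) : ‖y - x₀‖ ≤ (1 + r * L) * ‖x - y‖ := by
  have hxr : ‖x - x₀‖ ≤ r := by
    have : x ∈ Metric.ball x₀ ρ := of_not_not fun h => hx (hψ.eq_zero h)
    rw [mem_ball_iff_norm] at this
    linarith
  have hgap : r * 1 ≤ r * (L * ‖x - y‖) := mul_le_mul_of_nonneg_left (hψ.gap x y hx hy) hr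
  have htri := norm_sub_le_norm_sub_add_norm_sub y x x₀
  rw [norm_sub_rev y x] at htri
  linarith

theorem IsCutoff.lintegral_compl_ball_le {a p ρ r L T : ℝ} {u ψ : Eucl N → ℝ}
    (hψ : IsCutoff (Metric.ball x₀ ρ) L ψ) (ha : 0 ≤ a) (hr : 0 < r) (hL : 0 ≤ L)
    (hρ : r / 2 ≤ ρ) (hρr : ρ ≤ r)
    (hT : ∫⁻ y in (Metric.ball x₀ (r / 2))ᶜ,
      ENNReal.ofReal (|u y| ^ (p - 1) / ‖y - x₀‖ ^ ((N : ℝ) + a)) ≤ ENNReal.ofReal T)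
    {x : Eucl N} (hx : ψ x ≠ 0) :
    ∫⁻ y in (Metric.ball x₀ ρ)ᶜ, ENNReal.ofReal (|u y| ^ (p - 1) / ‖x - y‖ ^ ((N : ℝ) + a)) ≤
      ENNReal.ofReal ((1 + r * L) ^ ((N : ℝ) + a) * T) := by
  set c : ℝ := (1 + r * L) ^ ((N : ℝ) + a) with hc_def
  have hc : 0 ≤ c := by positivity
  have hkernel : ∀ y ∈ (Metric.ball x₀ ρ)ᶜ, |u y| ^ (p - 1) / ‖x - y‖ ^ ((N : ℝ) + a) ≤
      c * (|u y| ^ (p - 1) / ‖y - x₀‖ ^ ((N : ℝ) + a)) := fun y hy => by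
    have hle := hψ.norm_sub_center_le hr.le hρr hx hy
    have hy0 : 0 < ‖y - x₀‖ := by
      have : ρ ≤ ‖y - x₀‖ := by simpa [dist_eq_norm] using hy
      linarith
    have hxy : 0 < ‖x - y‖ := pos_of_mul_pos_right (hy0.trans_le hle) (by positivity)
    have hpow : ‖y - x₀‖ ^ ((N : ℝ) + a) ≤ c * ‖x - y‖ ^ ((N : ℝ) + a) := by
      rw [hc_def, ← Real.mul_rpow (by positivity) hxy.le]
      gcongr
    rw [← mul_div_assoc, div_le_div_iff₀ (by positivity) (by positivity)]
    calc _ ≤ |u y| ^ (p - 1) * (c * ‖x - y‖ ^ ((N : ℝ) + a)) := by gcongr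
      _ = _ := by ring
  calc _ ≤ ∫⁻ y in (Metric.ball x₀ ρ)ᶜ,
          ENNReal.ofReal c * ENNReal.ofReal (|u y| ^ (p - 1) / ‖y - x₀‖ ^ ((N : ℝ) + a)) :=
        setLIntegral_mono' measurableSet_ball.compl fun y hy => by
          rw [← ENNReal.ofReal_mul hc]
          exact ENNReal.ofReal_le_ofReal (hkernel y hy)
    _ = ENNReal.ofReal c * ∫⁻ y in (Metric.ball x₀ ρ)ᶜ,
          ENNReal.ofReal (|u y| ^ (p - 1) / ‖y - x₀‖ ^ ((N : ℝ) + a)) :=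
        lintegral_const_mul' _ _ ENNReal.ofReal_ne_top
    _ ≤ ENNReal.ofReal c * ENNReal.ofReal T :=
        mul_le_mul' le_rfl ((lintegral_mono_set
          (compl_subset_compl.2 (Metric.ball_subset_ball hρ))).trans hT)
    _ = ENNReal.ofReal (c * T) := (ENNReal.ofReal_mul hc).symm

end Ball

theorem exists_mul_pow_mul_rpow_le {A b ε : ℝ} (hA : 0 < A) (hb : 1 < b) (hε : 0 < ε) :
    ∃ ν > 0, ∃ σ ∈ Ioo (0 : ℝ) 1, ∀ j : ℕ, A * b ^ j * (ν * σ ^ j) ^ ε ≤ σ := by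
  have hb0 : 0 < b := by linarith
  set σ : ℝ := b ^ (-(1 / ε)) with hσ
  have hσ0 : 0 < σ := Real.rpow_pos_of_pos hb0 _
  have hσε : σ ^ ε = b⁻¹ := by
    rw [hσ, ← Real.rpow_mul hb0.le, neg_mul, one_div_mul_cancel hε.ne', Real.rpow_neg_one]
  refine ⟨(σ / A) ^ (1 / ε), by positivity, σ,
    ⟨hσ0, Real.rpow_lt_one_of_one_lt_of_neg hb (by simpa using hε)⟩, fun j => le_of_eq ?_⟩
  calc A * b ^ j * ((σ / A) ^ (1 / ε) * σ ^ j) ^ ε = A * b ^ j * (σ / A * (b⁻¹) ^ j) := by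
        rw [Real.mul_rpow (by positivity) (by positivity), ← Real.rpow_mul (by positivity),
          one_div_mul_cancel hε.ne', Real.rpow_one, ← Real.rpow_pow_comm hσ0.le, hσε]
    _ = σ := by
        rw [inv_pow]
        field_simp

section Levels

/-- The quantity iterated by the De Giorgi method: the integral of `H_r((u - k)₊)` over `S`. -/
noncomputable def levelEnergy {N : ℕ} (p s₁ sp r : ℝ) (u : Eucl N → ℝ) (k : ℝ) (S : Set (Eucl N)) :
    ENNReal :=
  ∫⁻ x in S, ENNReal.ofReal (bigH p s₁ sp r (excess u k x))

variable {N : ℕ} {p s₁ sp r k h lam M T : ℝ} {u ψ : Eucl N → ℝ} {S B : Set (Eucl N)} {x₀ : Eucl N}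

theorem levelEnergy_mono {l : ℝ} (hp : 0 ≤ p) (hr : 0 < r) (hkl : k ≤ l) (hSB : S ⊆ B) :
    levelEnergy p s₁ sp r u l S ≤ levelEnergy p s₁ sp r u k B :=
  (lintegral_mono_set hSB).trans <| lintegral_mono fun x => ENNReal.ofReal_le_ofReal <|
    bigH_mono hp hr (excess_nonneg u l x) (excess_anti hkl x)

theorem ae_le_of_levelEnergy_eq_zero (hr : 0 < r) (hu : Measurable u)
    (h : levelEnergy p s₁ sp r u k S = 0) : ∀ᵐ x ∂(volume.restrict S), u x ≤ k := by
  rw [levelEnergy, lintegral_eq_zero_iff (by fun_prop)] at h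
  filter_upwards [h] with x hx
  by_contra! hlt
  exact (ENNReal.ofReal_pos.2 (bigH_pos hr (excess_pos_iff.2 hlt))).ne' hx

theorem volume_superlevel_le (hp : 1 ≤ p) (hr : 0 < r) (hh : 0 < h) (hlam : 1 ≤ lam)
    (hu : Measurable u) {y : ℝ} {V : ENNReal}
    (hV : levelEnergy p s₁ sp r u k S ≤ ENNReal.ofReal (y * bigH p s₁ sp r (lam * h)) * V) :
    volume (S ∩ {x | k + h < u x}) ≤ ENNReal.ofReal (lam ^ p * y) * V := by
  have hH : 0 < bigH p s₁ sp r h := bigH_pos hr hh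
  have hset : MeasurableSet {x | k + h < u x} := measurableSet_lt measurable_const hu
  refine (ENNReal.mul_le_mul_iff_right (ENNReal.ofReal_pos.2 hH).ne' ENNReal.ofReal_ne_top).1 ?_
  calc ENNReal.ofReal (bigH p s₁ sp r h) * volume (S ∩ {x | k + h < u x})
      ≤ levelEnergy p s₁ sp r u k S := by
        rw [inter_comm, ← Measure.restrict_apply hset, levelEnergy]
        refine (mul_le_mul' le_rfl (measure_mono fun x (hx : k + h < u x) => ?_)).trans
          (mul_meas_ge_le_lintegral (by fun_prop) _)
        exact ENNReal.ofReal_le_ofReal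
          (bigH_mono (by linarith) hr hh.le (le_max_of_le_left (by linarith)))
    _ ≤ ENNReal.ofReal (y * (lam ^ p * bigH p s₁ sp r h)) * V := by
        refine hV.trans (mul_le_mul' ?_ le_rfl)
        rcases le_total y 0 with hy | hy
        · rw [ENNReal.ofReal_of_nonpos (mul_nonpos_of_nonpos_of_nonneg hy
            (bigH_nonneg hr (by positivity)))]
          exact zero_le
        · exact ENNReal.ofReal_le_ofReal
            (mul_le_mul_of_nonneg_left (bigH_mul_le hp hr hlam hh.le) hy)
    _ = ENNReal.ofReal (bigH p s₁ sp r h) * (ENNReal.ofReal (lam ^ p * y) * V) := by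
        rw [show y * (lam ^ p * bigH p s₁ sp r h) = bigH p s₁ sp r h * (lam ^ p * y) by ring,
          ENNReal.ofReal_mul hH.le, mul_assoc]

theorem IsCutoff.volume_support_inter_le {ρ L y : ℝ} (hψ : IsCutoff (Metric.ball x₀ ρ) L ψ)
    (hp : 1 ≤ p) (hr : 0 < r) (hρr : ρ ≤ r) (hh : 0 < h) (hlam : 1 ≤ lam) (hu : Measurable u)
    (hE : levelEnergy p s₁ sp r u k (Metric.ball x₀ ρ) ≤
      ENNReal.ofReal (y * bigH p s₁ sp r (lam * h)) * volume (Metric.ball x₀ r)) :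
    volume (Function.support ψ ∩ {x | k + h < u x}) ≤
      ENNReal.ofReal (min 1 (lam ^ p * y)) * volume (Metric.ball x₀ r) := by
  have hsupp : Function.support ψ ⊆ Metric.ball x₀ ρ := fun x hx => by
    by_contra hxρ
    exact hx (hψ.eq_zero hxρ)
  rcases min_choice 1 (lam ^ p * y) with hmin | hmin <;> rw [hmin]
  · rw [ENNReal.ofReal_one, one_mul]
    exact measure_mono (inter_subset_left.trans (hsupp.trans (Metric.ball_subset_ball hρr)))
  · exact (measure_mono (inter_subset_inter_left _ hsupp)).trans
      (volume_superlevel_le hp hr hh hlam hu hE)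

theorem mul_excess_add_le (hp : 1 ≤ p) (hr : 0 < r) (hh : 0 ≤ h) (hlam : 1 ≤ lam) (hM : 0 ≤ M)
    (hT : T ≤ M * smallH p s₁ sp r (lam * h)) (x : Eucl N) :
    T * excess u (k + h) x ≤ M * lam ^ p * bigH p s₁ sp r (excess u k x) := by
  have hw := excess_nonneg u k x
  have hH := bigH_nonneg (p := p) (s₁ := s₁) (sp := sp) hr hw
  rcases (excess_nonneg u (k + h) x).eq_or_lt with h0 | h0
  · rw [← h0, mul_zero]
    positivity
  · have hhw : h ≤ excess u k x := le_max_of_le_left (by linarith [excess_pos_iff.1 h0])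
    have := smallH_nonneg (p := p) (s₁ := s₁) (sp := sp) hr hw
    have hsmall : smallH p s₁ sp r (lam * h) ≤ lam ^ p * smallH p s₁ sp r (excess u k x) := by
      calc smallH p s₁ sp r (lam * h) ≤ lam ^ (p - 1) * smallH p s₁ sp r h :=
            smallH_mul_le hp hr hlam hh
        _ ≤ lam ^ p * smallH p s₁ sp r (excess u k x) :=
            mul_le_mul (Real.rpow_le_rpow_of_exponent_le hlam (by linarith))
              (smallH_mono hp hr hh hhw) (smallH_nonneg hr hh) (by positivity)
    calc T * excess u (k + h) x
        ≤ M * (lam ^ p * smallH p s₁ sp r (excess u k x)) * excess u k x := by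
          gcongr
          · exact hT.trans (mul_le_mul_of_nonneg_left hsmall hM)
          · exact excess_anti (by linarith) x
      _ = M * lam ^ p * bigH p s₁ sp r (excess u k x) := by
          rw [bigH_eq_mul_smallH (by linarith) hw]
          ring

theorem div_rpow_le_mul_one_div_rpow {b q : ℝ} (hr : 0 < r) (hlam : 1 ≤ lam) (hb : 0 ≤ b)
    (hbq : b ≤ q) : (4 * lam / r) ^ b ≤ (5 * lam) ^ q * (1 / r ^ b) := by
  rw [Real.div_rpow (by positivity) hr.le, ← mul_one_div]
  gcongr
  calc (4 * lam) ^ b ≤ (5 * lam) ^ b := by gcongr; norm_num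
    _ ≤ (5 * lam) ^ q := Real.rpow_le_rpow_of_exponent_le (by linarith) hbq

theorem caccioppoli_weights_le (hp : 1 ≤ p) (hs₁ : s₁ ∈ Ioo (0 : ℝ) 1) (hsp : sp ∈ Ioo (0 : ℝ) 1)
    (hr : 0 < r) (hh : 0 ≤ h) (hlam : 1 ≤ lam) (hM : 0 ≤ M)
    (hT : T ≤ M * smallH p s₁ sp r (lam * h)) (x : Eucl N) :
    ((4 * lam / r) ^ s₁ + (1 + 4 * lam) ^ ((N : ℝ) + sp * p) * T) * excess u (k + h) x +
        (4 * lam / r) ^ (sp * p) * excess u (k + h) x ^ p ≤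
      (1 + M) * (5 * lam) ^ ((N : ℝ) + p) * lam ^ p * bigH p s₁ sp r (excess u k x) := by
  set Q : ℝ := (5 * lam) ^ ((N : ℝ) + p)
  set w := excess u (k + h) x
  have hw : 0 ≤ w := excess_nonneg u (k + h) x
  have : (0 : ℝ) ≤ N := Nat.cast_nonneg N
  have hspp : sp * p ≤ p := mul_le_of_le_one_left (by linarith) hsp.2.le
  have hspp0 : 0 ≤ sp * p := mul_nonneg hsp.1.le (by linarith)
  have hH := bigH_nonneg (p := p) (s₁ := s₁) (sp := sp) hr (excess_nonneg u k x)
  have hgrad : (4 * lam / r) ^ s₁ * w + (4 * lam / r) ^ (sp * p) * w ^ p ≤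
      Q * (lam ^ p * bigH p s₁ sp r (excess u k x)) := by
    calc _ ≤ Q * (1 / r ^ s₁) * w + Q * (1 / r ^ (sp * p)) * w ^ p := by
          gcongr
          · exact div_rpow_le_mul_one_div_rpow hr hlam hs₁.1.le (by linarith [hs₁.2])
          · exact div_rpow_le_mul_one_div_rpow hr hlam hspp0 (by linarith)
      _ = Q * bigH p s₁ sp r w := by rw [bigH]; ring
      _ ≤ Q * bigH p s₁ sp r (excess u k x) := by
          gcongr
          exact bigH_mono (by linarith) hr hw (excess_anti (by linarith) x)
      _ ≤ _ := by
          gcongr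
          exact le_mul_of_one_le_left hH (Real.one_le_rpow hlam (by linarith))
  have htail : (1 + 4 * lam) ^ ((N : ℝ) + sp * p) * (T * w) ≤
      Q * (M * lam ^ p * bigH p s₁ sp r (excess u k x)) := by
    calc _ ≤ (1 + 4 * lam) ^ ((N : ℝ) + sp * p) *
          (M * lam ^ p * bigH p s₁ sp r (excess u k x)) :=
          mul_le_mul_of_nonneg_left (mul_excess_add_le hp hr hh hlam hM hT x) (by positivity)
      _ ≤ _ := by
          gcongr
          calc (1 + 4 * lam) ^ ((N : ℝ) + sp * p) ≤ (5 * lam) ^ ((N : ℝ) + sp * p) := by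
                gcongr
                linarith
            _ ≤ Q := Real.rpow_le_rpow_of_exponent_le (by linarith) (by linarith)
  linarith

theorem exists_gagliardo_excess_le [NeZero N] (hp : 1 < p) (hs₁ : s₁ ∈ Ioo (0 : ℝ) 1)
    (hsp : sp ∈ Ioo (0 : ℝ) 1) :
    ∃ C > 0, ∀ {Ω : Set (Eucl N)} {u ψ : Eucl N → ℝ} {x₀ : Eucl N} {r T M k h lam ρ : ℝ},
      Measurable u → IsWeakSolution p s₁ sp Ω u → 0 < r → 0 ≤ T → 0 ≤ M →
      closure (Metric.ball x₀ r) ⊆ Ω →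
      ∫⁻ y in (Metric.ball x₀ (r / 2))ᶜ,
        ENNReal.ofReal (|u y| ^ (p - 1) / ‖y - x₀‖ ^ ((N : ℝ) + sp * p)) ≤ ENNReal.ofReal T →
      0 ≤ k → 0 ≤ h → 1 ≤ lam → T ≤ M * smallH p s₁ sp r (lam * h) → r / 2 ≤ ρ → ρ ≤ r →
      IsCutoff (Metric.ball x₀ ρ) (4 * lam / r) ψ →
      gagliardo s₁ 1 univ (fun x => excess u (k + h) x * ψ x ^ p) +
          gagliardo sp p univ (fun x => excess u (k + h) x * ψ x) ≤
        ENNReal.ofReal (C * ((1 + M) * (5 * lam) ^ ((N : ℝ) + p) * lam ^ p)) *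
          levelEnergy p s₁ sp r u k (Metric.ball x₀ ρ) := by
  obtain ⟨C, hC, hcac⟩ := exists_caccioppoli (N := N) hp hs₁ hsp
  refine ⟨C, hC, fun {Ω u ψ x₀ r T M k h lam ρ} hu hsol hr hT0 hM hΩ hT hk hh hlam hTM hρ hρr hψ =>
    ?_⟩
  have hspp : 0 ≤ sp * p := mul_nonneg hsp.1.le (by linarith)
  have hL : 0 < 4 * lam / r := by positivity
  have hτ := fun x hx => hψ.lintegral_compl_ball_le (x := x) hspp hr hL.le hρ hρr hT hx
  rw [mul_div_cancel₀ _ hr.ne'] at hτ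
  have hw := excess_nonneg u (k + h)
  refine (hcac hu hsol Metric.isOpen_ball Metric.isBounded_ball.isCompact_closure
    ((closure_mono (Metric.ball_subset_ball hρr)).trans hΩ) (add_nonneg hk hh) hL hψ
    (by positivity) hτ).trans ?_
  rw [levelEnergy, ← lintegral_const_mul _ (by fun_prop), ← lintegral_const_mul _ (by fun_prop),
    ← lintegral_const_mul _ (by fun_prop), ← lintegral_add_left (by fun_prop)]
  refine lintegral_mono fun x => ?_
  have := hw x
  rw [← ENNReal.ofReal_mul (by positivity), ← ENNReal.ofReal_mul (by positivity),
    ← ENNReal.ofReal_mul (by positivity), ← ENNReal.ofReal_add (by positivity) (by positivity)]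
  refine ENNReal.ofReal_le_ofReal ?_
  have := mul_le_mul_of_nonneg_left
    (caccioppoli_weights_le (u := u) (k := k) hp.le hs₁ hsp hr hh hlam hM hTM x) hC.le
  linarith

theorem exists_mul_lintegral_rpow_le_gagliardo [NeZero N] {γ q : ℝ} (hγ : 0 < γ) (hq : 0 < q) :
    ∃ C > 0, ∀ {f : Eucl N → ℝ} {θ r ε : ℝ} {x₀ : Eucl N}, Measurable f → 0 < θ → θ ≤ 1 → 0 < r →
      ε ≤ γ * q / N → volume (Function.support f) ≤ ENNReal.ofReal θ * volume (Metric.ball x₀ r) →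
      ENNReal.ofReal (1 / r ^ (γ * q)) * (∫⁻ x, ENNReal.ofReal (|f x| ^ q)) ≤
        ENNReal.ofReal (C * θ ^ ε) * gagliardo γ q univ f := by
  obtain ⟨C, hC, hfk⟩ := exists_lintegral_rpow_le_gagliardo (N := N) hγ hq
  refine ⟨C, hC, fun {f θ r ε x₀} hf hθ hθ1 hr hε hsupp => ?_⟩
  refine (mul_le_mul' le_rfl (hfk f hf θ r hθ hr x₀ hsupp)).trans ?_
  rw [← mul_assoc, ← ENNReal.ofReal_mul (by positivity)]
  refine mul_le_mul' (ENNReal.ofReal_le_ofReal ?_) le_rfl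
  calc 1 / r ^ (γ * q) * (C * θ ^ (γ * q / N) * r ^ (γ * q)) = C * θ ^ (γ * q / N) := by field_simp
    _ ≤ C * θ ^ ε := by
        gcongr C * ?_
        exact Real.rpow_le_rpow_of_exponent_ge hθ hθ1 hε

theorem levelEnergy_le_of_eq_one (hr : 0 < r) (hu : Measurable u)
    (hS : MeasurableSet S) (hψ : Measurable ψ) (hψ1 : ∀ x ∈ S, ψ x = 1) :
    levelEnergy p s₁ sp r u k S ≤
      ENNReal.ofReal (1 / r ^ s₁) * (∫⁻ x, ENNReal.ofReal |excess u k x * ψ x ^ p|) +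
        ENNReal.ofReal (1 / r ^ (sp * p)) * ∫⁻ x, ENNReal.ofReal (|excess u k x * ψ x| ^ p) := by
  rw [← lintegral_const_mul _ (by fun_prop), ← lintegral_const_mul _ (by fun_prop),
    ← lintegral_add_left (by fun_prop)]
  refine (setLIntegral_mono' hS fun x hx => ?_).trans (setLIntegral_le_lintegral S _)
  have := excess_nonneg u k x
  rw [hψ1 x hx, Real.one_rpow, mul_one, abs_of_nonneg this,
    ← ENNReal.ofReal_mul (by positivity), ← ENNReal.ofReal_mul (by positivity),
    ← ENNReal.ofReal_add (by positivity) (by positivity)]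
  refine ENNReal.ofReal_le_ofReal (le_of_eq ?_)
  rw [bigH]
  ring

theorem exists_levelEnergy_le_gagliardo [NeZero N] (hp : 0 < p) (hs₁ : 0 < s₁) (hsp : 0 < sp) :
    ∃ C > 0, ∀ {u ψ : Eucl N → ℝ} {x₀ : Eucl N} {S : Set (Eucl N)} {r k θ : ℝ}, Measurable u →
      Measurable ψ → MeasurableSet S → 0 < r → (∀ x ∈ S, ψ x = 1) → 0 < θ → θ ≤ 1 →
      volume (Function.support ψ ∩ {x | k < u x}) ≤
        ENNReal.ofReal θ * volume (Metric.ball x₀ r) →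
      levelEnergy p s₁ sp r u k S ≤ ENNReal.ofReal (C * θ ^ (min s₁ (sp * p) / N)) *
        (gagliardo s₁ 1 univ (fun x => excess u k x * ψ x ^ p) +
          gagliardo sp p univ fun x => excess u k x * ψ x) := by
  obtain ⟨C₁, hC₁, h₁⟩ := exists_mul_lintegral_rpow_le_gagliardo (N := N) hs₁ one_pos
  obtain ⟨C₂, hC₂, h₂⟩ := exists_mul_lintegral_rpow_le_gagliardo (N := N) hsp hp
  simp only [Real.rpow_one, mul_one] at h₁
  refine ⟨C₁ + C₂, by positivity, fun {u ψ x₀ S r k θ} hu hψ hS hr hψ1 hθ hθ1 hvol => ?_⟩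
  have hsupp : ∀ f : Eucl N → ℝ, (∀ x, ψ x = 0 → f x = 0) →
      volume (Function.support fun x => excess u k x * f x) ≤
        ENNReal.ofReal θ * volume (Metric.ball x₀ r) := by
    refine fun f hf => (measure_mono fun x (hx : excess u k x * f x ≠ 0) => ?_).trans hvol
    exact ⟨fun h => right_ne_zero_of_mul hx (hf x h),
      excess_pos_iff.1 ((excess_nonneg u k x).lt_of_ne' (left_ne_zero_of_mul hx))⟩
  have hε₁ : min s₁ (sp * p) / N ≤ s₁ / N := by gcongr; exact min_le_left _ _
  have hε₂ : min s₁ (sp * p) / N ≤ sp * p / N := by gcongr; exact min_le_right _ _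
  refine (levelEnergy_le_of_eq_one hr hu hS hψ hψ1).trans ?_
  rw [mul_add]
  refine add_le_add
    ((h₁ (by fun_prop) hθ hθ1 hr hε₁ (hsupp _ fun x hx => by rw [hx, Real.zero_rpow hp.ne'])).trans
      ?_)
    ((h₂ (by fun_prop) hθ hθ1 hr hε₂ (hsupp _ fun x hx => hx)).trans ?_)
  · exact mul_le_mul' (ENNReal.ofReal_le_ofReal (by gcongr; linarith)) le_rfl
  · exact mul_le_mul' (ENNReal.ofReal_le_ofReal (by gcongr; linarith)) le_rfl

end Levels

section Iteration

/-- One step of the De Giorgi iteration below height `K`: raising the level by `K / lam` and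
shrinking the ball by `r / (2 * lam)` turns the bound `y` for the energy, measured in units of
`H_r(K)` times the volume of the ball of radius `r`, into `c * lam ^ m * y ^ (1 + ε)`. -/
def HasLevelDecay {N : ℕ} (p s₁ sp c m ε : ℝ) (u : Eucl N → ℝ) (x₀ : Eucl N) (r K : ℝ) : Prop :=
  ∀ k lam ρ y : ℝ, 0 ≤ k → 1 ≤ lam → r / 2 + r / (2 * lam) ≤ ρ → ρ ≤ r → 0 < y →
    levelEnergy p s₁ sp r u k (Metric.ball x₀ ρ) ≤
      ENNReal.ofReal (y * bigH p s₁ sp r K) * volume (Metric.ball x₀ r) →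
    levelEnergy p s₁ sp r u (k + K / lam) (Metric.ball x₀ (ρ - r / (2 * lam))) ≤
      ENNReal.ofReal (c * lam ^ m * y ^ ε * (y * bigH p s₁ sp r K)) * volume (Metric.ball x₀ r)

variable {N : ℕ} {p s₁ sp : ℝ}

theorem exists_hasLevelDecay [NeZero N] {M : ℝ} (hp : 1 < p) (hs₁ : s₁ ∈ Ioo (0 : ℝ) 1)
    (hsp : sp ∈ Ioo (0 : ℝ) 1) (hM : 0 ≤ M) :
    ∃ c > 0, ∃ m > 0, ∃ ε > 0, ∀ {Ω : Set (Eucl N)} {u : Eucl N → ℝ} {x₀ : Eucl N} {r T K : ℝ},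
      Measurable u → IsWeakSolution p s₁ sp Ω u → 0 < r → 0 ≤ T →
      closure (Metric.ball x₀ r) ⊆ Ω →
      ∫⁻ y in (Metric.ball x₀ (r / 2))ᶜ,
        ENNReal.ofReal (|u y| ^ (p - 1) / ‖y - x₀‖ ^ ((N : ℝ) + sp * p)) ≤ ENNReal.ofReal T →
      0 < K → T ≤ M * smallH p s₁ sp r K → HasLevelDecay p s₁ sp c m ε u x₀ r K := by
  obtain ⟨C, hC, hcac⟩ := exists_gagliardo_excess_le (N := N) hp hs₁ hsp
  obtain ⟨D, hD, hsob⟩ :=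
    exists_levelEnergy_le_gagliardo (N := N) (p := p) (by linarith) hs₁.1 hsp.1
  have hN : (0 : ℝ) < N := by exact_mod_cast NeZero.pos N
  set ε : ℝ := min s₁ (sp * p) / N
  have hε : 0 < ε := div_pos (lt_min hs₁.1 (mul_pos hsp.1 (by linarith))) hN
  refine ⟨D * C * (1 + M) * 5 ^ ((N : ℝ) + p), by positivity, (N : ℝ) + p + p + p * ε,
    by positivity, ε, hε, fun {Ω u x₀ r T K} hu hsol hr hT0 hΩ hT hK hTK k lam ρ y hk hlam hρ hρr hy
    hE => ?_⟩
  have hlam0 : 0 < lam := by linarith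
  have hη : 0 < r / (2 * lam) := by positivity
  have hKlam : lam * (K / lam) = K := mul_div_cancel₀ K (by positivity)
  obtain ⟨ψ, hψ, hψ1⟩ := exists_isCutoff_ball x₀ (sub_lt_self ρ hη)
  rw [sub_sub_cancel, show 2 / (r / (2 * lam)) = 4 * lam / r by field_simp; norm_num] at hψ
  rw [← hKlam] at hTK
  have hθ : 0 < min 1 (lam ^ p * y) := lt_min one_pos (by positivity)
  have hvol := hψ.volume_support_inter_le (h := K / lam) hp.le hr hρr (by positivity) hlam hu
    (hKlam.symm ▸ hE)
  have hH := bigH_pos (p := p) (s₁ := s₁) (sp := sp) hr hK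
  calc levelEnergy p s₁ sp r u (k + K / lam) (Metric.ball x₀ (ρ - r / (2 * lam)))
      ≤ ENNReal.ofReal (D * min 1 (lam ^ p * y) ^ ε) *
          (ENNReal.ofReal (C * ((1 + M) * (5 * lam) ^ ((N : ℝ) + p) * lam ^ p)) *
            (ENNReal.ofReal (y * bigH p s₁ sp r K) * volume (Metric.ball x₀ r))) :=
        (hsob hu hψ.continuous.measurable measurableSet_ball hr hψ1 hθ (min_le_left _ _) hvol).trans
          (mul_le_mul' le_rfl ((hcac hu hsol hr hT0 hM hΩ hT hk (by positivity) hlam hTK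
            (by linarith) hρr hψ).trans (mul_le_mul' le_rfl hE)))
    _ ≤ _ := by
        rw [← mul_assoc, ← mul_assoc, ← ENNReal.ofReal_mul (by positivity),
          ← ENNReal.ofReal_mul (by positivity)]
        refine mul_le_mul' (ENNReal.ofReal_le_ofReal ?_) le_rfl
        calc _ ≤ D * (lam ^ p * y) ^ ε * (C * ((1 + M) * (5 * lam) ^ ((N : ℝ) + p) * lam ^ p)) *
              (y * bigH p s₁ sp r K) := by
              gcongr
              exact min_le_right _ _
          _ = _ := by
              rw [Real.mul_rpow (by positivity) hy.le, Real.mul_rpow (by norm_num) (by positivity),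
                ← Real.rpow_mul (by positivity), Real.rpow_add hlam0 _ (p * ε),
                Real.rpow_add hlam0 ((N : ℝ) + p) p]
              ring

theorem HasLevelDecay.levelEnergy_le {c m ε ν σ r K : ℝ} {u : Eucl N → ℝ} {x₀ : Eucl N}
    (h : HasLevelDecay p s₁ sp c m ε u x₀ r K) (hr : 0 < r) (hK : 0 < K) (hν : 0 < ν) (hσ : 0 < σ)
    (hstep : ∀ j : ℕ, c * (2 : ℝ) ^ m * ((2 : ℝ) ^ m) ^ j * (ν * σ ^ j) ^ ε ≤ σ)
    (h0 : levelEnergy p s₁ sp r u 0 (Metric.ball x₀ r) ≤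
      ENNReal.ofReal (ν * bigH p s₁ sp r K) * volume (Metric.ball x₀ r)) (j : ℕ) :
    levelEnergy p s₁ sp r u (K * (1 - (1 / 2) ^ j)) (Metric.ball x₀ (r / 2 + r / 2 * (1 / 2) ^ j)) ≤
      ENNReal.ofReal (ν * σ ^ j * bigH p s₁ sp r K) * volume (Metric.ball x₀ r) := by
  induction j with
  | zero => simpa using h0
  | succ j ih =>
    have hhalf : ((1 : ℝ) / 2) ^ j ≤ 1 := pow_le_one₀ (by norm_num) (by norm_num)
    have hshrink : r / (2 * 2 ^ (j + 1)) = r / 2 * (1 / 2) ^ (j + 1) := by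
      rw [one_div, inv_pow]
      field_simp
    have hlevel : K * (1 - (1 / 2) ^ j) + K / 2 ^ (j + 1) = K * (1 - (1 / 2) ^ (j + 1)) := by
      rw [div_eq_mul_one_div K, ← one_div_pow]
      ring
    have hradius : r / 2 + r / 2 * (1 / 2) ^ j - r / (2 * 2 ^ (j + 1)) =
        r / 2 + r / 2 * (1 / 2) ^ (j + 1) := by
      rw [hshrink]
      ring
    have hpow : ((2 : ℝ) ^ (j + 1)) ^ m = 2 ^ m * (2 ^ m) ^ j := by
      rw [← Real.rpow_natCast, ← Real.rpow_mul (by norm_num), mul_comm, Real.rpow_mul (by norm_num),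
        Real.rpow_natCast, pow_succ']
    have hnext := h (K * (1 - (1 / 2) ^ j)) (2 ^ (j + 1)) (r / 2 + r / 2 * (1 / 2) ^ j) (ν * σ ^ j)
      (mul_nonneg hK.le (by linarith)) (one_le_pow₀ (by norm_num))
      (by rw [hshrink, pow_succ]; nlinarith [show (0 : ℝ) ≤ (1 / 2) ^ j by positivity])
      (by nlinarith) (by positivity) ih
    rw [hlevel, hradius, hpow] at hnext
    refine hnext.trans (mul_le_mul' (ENNReal.ofReal_le_ofReal ?_) le_rfl)
    calc _ ≤ σ * (ν * σ ^ j * bigH p s₁ sp r K) :=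
          mul_le_mul_of_nonneg_right (by rw [← mul_assoc]; exact hstep j)
            (mul_nonneg (by positivity) (bigH_nonneg hr hK.le))
      _ = ν * σ ^ (j + 1) * bigH p s₁ sp r K := by ring

theorem exists_ae_le_of_hasLevelDecay {c m ε : ℝ} (hp : 0 ≤ p) (hc : 0 < c) (hm : 0 < m)
    (hε : 0 < ε) :
    ∃ ν > 0, ∀ {u : Eucl N → ℝ} {x₀ : Eucl N} {r K : ℝ}, Measurable u → 0 < r → 0 < K →
      HasLevelDecay p s₁ sp c m ε u x₀ r K →
      levelEnergy p s₁ sp r u 0 (Metric.ball x₀ r) ≤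
        ENNReal.ofReal (ν * bigH p s₁ sp r K) * volume (Metric.ball x₀ r) →
      ∀ᵐ x ∂(volume.restrict (Metric.ball x₀ (r / 2))), u x ≤ K := by
  obtain ⟨ν, hν, σ, ⟨hσ0, hσ1⟩, hstep⟩ := exists_mul_pow_mul_rpow_le (A := c * 2 ^ m)
    (by positivity) (Real.one_lt_rpow one_lt_two hm) hε
  refine ⟨ν, hν, fun {u x₀ r K} hu hr hK hdecay h0 =>
    ae_le_of_levelEnergy_eq_zero (p := p) (s₁ := s₁) (sp := sp) hr hu (le_antisymm ?_ zero_le)⟩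
  have hlim : Filter.Tendsto (fun j : ℕ => ENNReal.ofReal (ν * σ ^ j * bigH p s₁ sp r K) *
      volume (Metric.ball x₀ r)) Filter.atTop (nhds 0) := by
    have hpow := ((tendsto_pow_atTop_nhds_zero_of_lt_one hσ0.le hσ1).const_mul ν).mul_const
      (bigH p s₁ sp r K)
    simpa using ENNReal.Tendsto.mul_const (ENNReal.tendsto_ofReal hpow)
      (Or.inr (measure_ball_lt_top (μ := volume) (x := x₀) (r := r)).ne)
  refine ge_of_tendsto' hlim fun j => (levelEnergy_mono hp hr ?_ (Metric.ball_subset_ball ?_)).trans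
    (hdecay.levelEnergy_le hr hK hν hσ0 hstep h0 j)
  · exact mul_le_of_le_one_right hK.le (sub_le_self _ (by positivity))
  · exact le_add_of_nonneg_right (by positivity)

end Iteration

section Congr

variable {N : ℕ} {p s₁ sp γ q : ℝ} {S Ω : Set (Eucl N)} {u v : Eucl N → ℝ}

theorem ae_fst_snd_eq (h : u =ᵐ[volume] v) :
    ∀ᵐ z : Eucl N × Eucl N, u z.1 = v z.1 ∧ u z.2 = v z.2 := by
  rw [Measure.volume_eq_prod]
  exact (Measure.quasiMeasurePreserving_fst.ae h).and (Measure.quasiMeasurePreserving_snd.ae h)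

theorem MemFracSobolev.congr_ae (h : u =ᵐ[volume] v) (hu : MemFracSobolev γ q S u) :
    MemFracSobolev γ q S v := by
  refine ⟨(memLp_congr_ae (ae_restrict_of_ae h)).1 hu.1, ?_⟩
  refine lt_of_eq_of_lt (lintegral_congr_ae (ae_restrict_of_ae ?_)) hu.2
  filter_upwards [ae_fst_snd_eq h] with z hz
  rw [hz.1, hz.2]

theorem IsWeakSolution.congr_ae (h : u =ᵐ[volume] v) (hu : IsWeakSolution p s₁ sp Ω u) :
    IsWeakSolution p s₁ sp Ω v := by
  obtain ⟨hu1, hup, ⟨hmeas, hloc, htail⟩, Z, hZ, hZs, heq⟩ := hu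
  refine ⟨fun U hU hUc hUΩ => (hu1 U hU hUc hUΩ).congr_ae h,
    fun U hU hUc hUΩ => (hup U hU hUc hUΩ).congr_ae h,
    ⟨hmeas.congr h, hloc.congr (h.mono fun x hx => by simp only [hx]),
      htail.congr (h.mono fun x hx => by simp only [hx])⟩, Z, hZ, ?_, fun φ hφ1 hφp hφc hφΩ => ?_⟩
  · filter_upwards [hZs, ae_fst_snd_eq h] with z hz huv
    rwa [← huv.1, ← huv.2]
  · rw [← heq φ hφ1 hφp hφc hφΩ]
    congr 1
    refine integral_congr_ae ?_
    filter_upwards [ae_fst_snd_eq h] with z hz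
    rw [hz.1, hz.2]

theorem MemFracSobolev.neg (hu : MemFracSobolev γ q S u) :
    MemFracSobolev γ q S (fun x => -u x) := by
  refine ⟨hu.1.neg, lt_of_eq_of_lt ?_ hu.2⟩
  simp only [gagliardo, neg_sub_neg, abs_sub_comm]

theorem IsWeakSolution.neg (hu : IsWeakSolution p s₁ sp Ω u) :
    IsWeakSolution p s₁ sp Ω (fun x => -u x) := by
  obtain ⟨hu1, hup, ⟨hmeas, hloc, htail⟩, Z, hZ, hZs, heq⟩ := hu
  refine ⟨fun U hU hUc hUΩ => (hu1 U hU hUc hUΩ).neg, fun U hU hUc hUΩ => (hup U hU hUc hUΩ).neg,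
    ⟨hmeas.neg, by simpa only [abs_neg] using hloc, by simpa only [abs_neg] using htail⟩,
    fun z => -Z z, hZ.neg, hZs.mono fun z hz => ?_, fun φ hφ1 hφp hφc hφΩ => ?_⟩
  · rw [neg_sub_neg, ← neg_sub (u z.1)]
    exact neg_mem_sgnSet hz
  · rw [← neg_eq_zero, ← heq φ hφ1 hφp hφc hφΩ, neg_add, ← integral_neg, ← integral_neg]
    congr 1 <;> refine integral_congr_ae (ae_of_all _ fun z => ?_)
    · ring
    · simp only [neg_sub_neg, abs_sub_comm (u z.2)]
      ring

theorem Tail_neg (u : Eucl N → ℝ) (x₀ : Eucl N) (R : ℝ) :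
    Tail p sp (fun x => -u x) x₀ R = Tail p sp u x₀ R := by
  simp only [Tail, abs_neg]

theorem Tail_congr_ae (h : u =ᵐ[volume] v) (x₀ : Eucl N) (R : ℝ) :
    Tail p sp u x₀ R = Tail p sp v x₀ R := by
  unfold Tail
  congr 2
  exact integral_congr_ae (ae_restrict_of_ae (h.mono fun x hx => by simp only [hx]))

end Congr

section Tail

variable {N : ℕ} {p sp : ℝ} {u : Eucl N → ℝ} {x₀ : Eucl N} {R : ℝ}

theorem one_add_norm_le_mul_norm_sub (hR : 0 < R) {x : Eucl N} (hx : R ≤ ‖x - x₀‖) :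
    1 + ‖x‖ ≤ ((1 + ‖x₀‖) / R + 1) * ‖x - x₀‖ := by
  have htriangle : ‖x‖ ≤ ‖x - x₀‖ + ‖x₀‖ := by simpa using norm_add_le (x - x₀) x₀
  have hscale : 1 + ‖x₀‖ ≤ (1 + ‖x₀‖) / R * ‖x - x₀‖ := by
    rw [div_mul_eq_mul_div, le_div_iff₀ hR]
    gcongr
  linarith

theorem MemTailSpace.integrableOn_compl_ball {a q : ℝ} (ha : 0 ≤ a) (hu : Measurable u)
    (h : MemTailSpace q a u) (hR : 0 < R) :
    IntegrableOn (fun x => |u x| ^ q / ‖x - x₀‖ ^ ((N : ℝ) + a)) (Metric.ball x₀ R)ᶜ := by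
  set c : ℝ := (1 + ‖x₀‖) / R + 1
  have hc : 0 < c := by positivity
  refine (h.2.2.const_mul (c ^ ((N : ℝ) + a))).integrableOn.mono'
    (Measurable.aestronglyMeasurable (by fun_prop))
    ((ae_restrict_iff' measurableSet_ball.compl).2 (ae_of_all _ fun x hx => ?_))
  have hxR : R ≤ ‖x - x₀‖ := by simpa [dist_eq_norm] using hx
  have hpos : 0 < ‖x - x₀‖ := hR.trans_le hxR
  have hweight : (1 + ‖x‖) ^ ((N : ℝ) + a) ≤ c ^ ((N : ℝ) + a) * ‖x - x₀‖ ^ ((N : ℝ) + a) := by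
    rw [← Real.mul_rpow hc.le hpos.le]
    exact Real.rpow_le_rpow (by positivity) (one_add_norm_le_mul_norm_sub hR hxR) (by positivity)
  rw [Real.norm_of_nonneg (by positivity), ← mul_div_assoc,
    div_le_div_iff₀ (by positivity) (by positivity)]
  linarith [mul_le_mul_of_nonneg_left hweight (by positivity : 0 ≤ |u x| ^ q)]

theorem Tail_rpow (hp : 1 < p) (hR : 0 < R) :
    Tail p sp u x₀ R ^ (p - 1) = R ^ (sp * p) * ∫ x in (Metric.ball x₀ R)ᶜ,
      |u x| ^ (p - 1) / ‖x - x₀‖ ^ ((N : ℝ) + sp * p) := by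
  have : 0 ≤ ∫ x in (Metric.ball x₀ R)ᶜ, |u x| ^ (p - 1) / ‖x - x₀‖ ^ ((N : ℝ) + sp * p) :=
    integral_nonneg fun x => by positivity
  rw [Tail, ← Real.rpow_mul (by positivity), one_div_mul_cancel (by linarith), Real.rpow_one]

theorem Tail_nonneg (hR : 0 ≤ R) : 0 ≤ Tail p sp u x₀ R :=
  Real.rpow_nonneg
    (mul_nonneg (Real.rpow_nonneg hR _) (integral_nonneg fun x => by positivity)) _

theorem MemTailSpace.lintegral_compl_ball_eq (hp : 1 < p) (hsp : 0 ≤ sp) (hu : Measurable u)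
    (h : MemTailSpace (p - 1) (sp * p) u) (hR : 0 < R) :
    ∫⁻ x in (Metric.ball x₀ R)ᶜ, ENNReal.ofReal (|u x| ^ (p - 1) / ‖x - x₀‖ ^ ((N : ℝ) + sp * p)) =
      ENNReal.ofReal (R ^ (-(sp * p)) * Tail p sp u x₀ R ^ (p - 1)) := by
  rw [Tail_rpow hp hR, ← mul_assoc, ← Real.rpow_add hR, neg_add_cancel, Real.rpow_zero, one_mul,
    ofReal_integral_eq_lintegral_ofReal
      (h.integrableOn_compl_ball (mul_nonneg hsp (by linarith)) hu hR)
      (ae_of_all _ fun x => by simp only [Pi.zero_apply]; positivity)]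

end Tail

section Inverse

variable {p s₁ sp r c t y : ℝ}

theorem incrInv_nonneg (f : ℝ → ℝ) (y : ℝ) : 0 ≤ incrInv f y :=
  Real.sInf_nonneg fun _ ht => ht.1

theorem le_apply_incrInv {f : ℝ → ℝ} (hf : Continuous f) (ht : 0 ≤ t) (hy : y ≤ f t) :
    y ≤ f (incrInv f y) :=
  ((isClosed_Ici.inter (isClosed_Ici.preimage hf)).csInf_mem (s := {t | 0 ≤ t ∧ y ≤ f t})
    ⟨t, ht, hy⟩ ⟨0, fun _ hs => hs.1⟩).2

theorem le_bigH_incrInv (hp : 0 ≤ p) (hr : 0 < r) :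
    y ≤ bigH p s₁ sp r (incrInv (bigH p s₁ sp r) y) := by
  refine le_apply_incrInv (t := |y| * r ^ s₁) ?_ (by positivity) ?_
  · unfold bigH
    fun_prop (disch := assumption)
  · rw [bigH, mul_div_cancel_right₀ _ (by positivity)]
    exact (le_abs_self y).trans (le_add_of_nonneg_right (by positivity))

theorem le_smallH_incrInv (hp : 1 < p) (hr : 0 < r) :
    y ≤ smallH p s₁ sp r (incrInv (smallH p s₁ sp r) y) := by
  refine le_apply_incrInv (t := (|y| * r ^ (sp * p)) ^ (1 / (p - 1))) ?_ (by positivity) ?_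
  · have : 0 ≤ p - 1 := by linarith
    unfold smallH
    fun_prop (disch := assumption)
  · rw [smallH, ← Real.rpow_mul (by positivity), one_div_mul_cancel (by linarith), Real.rpow_one,
      mul_div_cancel_right₀ _ (by positivity)]
    exact (le_abs_self y).trans (le_add_of_nonneg_left (by positivity))

theorem le_inv_mul_bigH_of_mul_incrInv_le (hp : 1 ≤ p) (hr : 0 < r) (hc : 1 ≤ c)
    (h : c * incrInv (bigH p s₁ sp r) y ≤ t) : y ≤ c⁻¹ * bigH p s₁ sp r t := by
  have hX := incrInv_nonneg (bigH p s₁ sp r) y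
  rw [le_inv_mul_iff₀ (by linarith)]
  calc c * y ≤ c * bigH p s₁ sp r (incrInv (bigH p s₁ sp r) y) := by
        gcongr
        exact le_bigH_incrInv (by linarith) hr
    _ ≤ bigH p s₁ sp r (c * incrInv (bigH p s₁ sp r) y) := mul_bigH_le hp hr hc hX
    _ ≤ bigH p s₁ sp r t := bigH_mono (by linarith) hr (by positivity) h

theorem le_mul_smallH_of_incrInv_le_mul (hp : 1 < p) (hr : 0 < r) (hc : 1 ≤ c) (ht : 0 ≤ t)
    (h : incrInv (smallH p s₁ sp r) y ≤ c * t) : y ≤ c ^ (p - 1) * smallH p s₁ sp r t :=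
  calc y ≤ smallH p s₁ sp r (incrInv (smallH p s₁ sp r) y) := le_smallH_incrInv hp hr
    _ ≤ smallH p s₁ sp r (c * t) := smallH_mono hp.le hr (incrInv_nonneg _ _) h
    _ ≤ c ^ (p - 1) * smallH p s₁ sp r t := smallH_mul_le hp.le hr hc ht

end Inverse

section LocalBound

variable {N : ℕ} {p s₁ sp δ r : ℝ} {u v : Eucl N → ℝ} {x₀ : Eucl N} {Ω : Set (Eucl N)}

/-- The right-hand side of the supremum estimate for `u₊`. -/
noncomputable def supBound (p s₁ sp C δ : ℝ) (u : Eucl N → ℝ) (x₀ : Eucl N) (r : ℝ) : ℝ :=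
  C * incrInv (bigH p s₁ sp r) (⨍ y in Metric.ball x₀ r, bigH p s₁ sp r (max (u y) 0)) +
    δ * incrInv (smallH p s₁ sp r) (r ^ (-(sp * p)) * (Tail p sp u x₀ (r / 2) ^ (p - 1) + 1))

theorem supBound_congr_ae {C : ℝ} (h : u =ᵐ[volume] v) :
    supBound p s₁ sp C δ u x₀ r = supBound p s₁ sp C δ v x₀ r := by
  have havg : ⨍ y in Metric.ball x₀ r, bigH p s₁ sp r (max (u y) 0) =
      ⨍ y in Metric.ball x₀ r, bigH p s₁ sp r (max (v y) 0) :=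
    average_congr (ae_restrict_of_ae (h.mono fun x hx => by simp only [hx]))
  rw [supBound, supBound, havg, Tail_congr_ae h]

theorem IsWeakSolution.integrableOn_bigH_posPart (hp : 1 < p) (hu : Measurable u)
    (hsol : IsWeakSolution p s₁ sp Ω u) (hr : 0 < r) (hB : closure (Metric.ball x₀ r) ⊆ Ω) :
    IntegrableOn (fun x => bigH p s₁ sp r (max (u x) 0)) (Metric.ball x₀ r) := by
  have hc := (Metric.isBounded_ball (x := x₀) (r := r)).isCompact_closure
  have hint : ∀ {γ q : ℝ}, 0 < q → MemFracSobolevLoc γ q Ω u →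
      IntegrableOn (fun x => |u x| ^ q) (Metric.ball x₀ r) := fun hq h =>
    (lintegral_ofReal_ne_top_iff_integrable (Measurable.aestronglyMeasurable (by fun_prop))
      (ae_of_all _ fun x => by simp only [Pi.zero_apply]; positivity)).1
      ((h _ Metric.isOpen_ball hc hB).lintegral_rpow_lt_top hq).ne
  refine (((hint one_pos hsol.1).div_const (r ^ s₁)).add
    ((hint (by linarith) hsol.2.1).div_const (r ^ (sp * p)))).mono'
    (Measurable.aestronglyMeasurable (by fun_prop)) (ae_of_all _ fun x => ?_)
  rw [Real.norm_of_nonneg (bigH_nonneg hr (le_max_right _ _))]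
  have hle : bigH p s₁ sp r (max (u x) 0) ≤ bigH p s₁ sp r |u x| :=
    bigH_mono (by linarith) hr (le_max_right _ _) (max_le (le_abs_self _) (abs_nonneg _))
  simpa only [bigH, Pi.add_apply, Real.rpow_one] using hle

theorem IsWeakSolution.levelEnergy_zero_eq (hp : 1 < p) (hu : Measurable u)
    (hsol : IsWeakSolution p s₁ sp Ω u) (hr : 0 < r) (hB : closure (Metric.ball x₀ r) ⊆ Ω) :
    levelEnergy p s₁ sp r u 0 (Metric.ball x₀ r) =
      ENNReal.ofReal (⨍ y in Metric.ball x₀ r, bigH p s₁ sp r (max (u y) 0)) *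
        volume (Metric.ball x₀ r) := by
  have hfin : volume (Metric.ball x₀ r) ≠ ⊤ := measure_ball_lt_top.ne
  simp only [levelEnergy, excess, sub_zero]
  rw [← ofReal_integral_eq_lintegral_ofReal (hsol.integrableOn_bigH_posPart hp hu hr hB)
    (ae_of_all _ fun x => bigH_nonneg hr (le_max_right _ _)), ← measure_smul_setAverage _ hfin,
    smul_eq_mul, ENNReal.ofReal_mul measureReal_nonneg, ofReal_measureReal hfin, mul_comm]

theorem exists_ae_le_of_supBound_lt [NeZero N] (hp : 1 < p) (hs₁ : s₁ ∈ Ioo (0 : ℝ) 1)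
    (hsp : sp ∈ Ioo (0 : ℝ) 1) (hδ : 0 < δ) :
    ∃ C > 0, ∀ {Ω : Set (Eucl N)} {u : Eucl N → ℝ} {x₀ : Eucl N} {r K : ℝ}, Measurable u →
      IsWeakSolution p s₁ sp Ω u → 0 < r → closure (Metric.ball x₀ r) ⊆ Ω →
      supBound p s₁ sp C δ u x₀ r < K →
      ∀ᵐ x ∂(volume.restrict (Metric.ball x₀ (r / 2))), u x ≤ K := by
  set b : ℝ := max 1 δ⁻¹
  obtain ⟨c, hc, m, hm, ε, hε, hdecay⟩ := exists_hasLevelDecay (N := N)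
    (M := 2 ^ (sp * p) * b ^ (p - 1)) hp hs₁ hsp (by positivity)
  obtain ⟨ν, hν, hiter⟩ := exists_ae_le_of_hasLevelDecay (N := N) (p := p) (s₁ := s₁) (sp := sp)
    (by linarith) hc hm hε
  refine ⟨max 1 ν⁻¹, by positivity, fun {Ω u x₀ r K} hu hsol hr hB hK => ?_⟩
  set avg := ⨍ y in Metric.ball x₀ r, bigH p s₁ sp r (max (u y) 0)
  set X := incrInv (bigH p s₁ sp r) avg
  set Y := r ^ (-(sp * p)) * (Tail p sp u x₀ (r / 2) ^ (p - 1) + 1)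
  set W := incrInv (smallH p s₁ sp r) Y
  have hX : 0 ≤ max 1 ν⁻¹ * X := mul_nonneg (by positivity) (incrInv_nonneg _ _)
  have hW : 0 ≤ δ * W := mul_nonneg hδ.le (incrInv_nonneg _ _)
  replace hK : max 1 ν⁻¹ * X + δ * W < K := hK
  have hK0 : 0 < K := by linarith
  have hT : ∫⁻ y in (Metric.ball x₀ (r / 2))ᶜ, ENNReal.ofReal
      (|u y| ^ (p - 1) / ‖y - x₀‖ ^ ((N : ℝ) + sp * p)) ≤ ENNReal.ofReal (2 ^ (sp * p) * Y) := by
    rw [hsol.2.2.1.lintegral_compl_ball_eq hp hsp.1.le hu (by positivity)]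
    refine ENNReal.ofReal_le_ofReal ?_
    rw [Real.div_rpow hr.le zero_le_two, Real.rpow_neg zero_le_two, div_inv_eq_mul, ← mul_assoc,
      mul_comm (r ^ _)]
    gcongr
    linarith
  have hWK : W ≤ b * K := by
    calc W = δ⁻¹ * (δ * W) := (inv_mul_cancel_left₀ hδ.ne' W).symm
      _ ≤ b * K := mul_le_mul (le_max_right _ _) (by linarith) hW (by positivity)
  refine hiter hu hr hK0 (hdecay hu hsol hr ?_ hB hT hK0 ?_) ?_
  · have := Tail_nonneg (p := p) (sp := sp) (u := u) (x₀ := x₀) (half_pos hr).le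
    positivity
  · rw [mul_assoc]
    gcongr
    exact le_mul_smallH_of_incrInv_le_mul hp hr (le_max_left _ _) hK0.le hWK
  · rw [hsol.levelEnergy_zero_eq hp hu hr hB]
    refine mul_le_mul' (ENNReal.ofReal_le_ofReal ?_) le_rfl
    calc avg ≤ (max 1 ν⁻¹)⁻¹ * bigH p s₁ sp r K :=
          le_inv_mul_bigH_of_mul_incrInv_le hp.le hr (le_max_left _ _) (by linarith)
      _ ≤ ν * bigH p s₁ sp r K := by
          gcongr
          · exact bigH_nonneg hr hK0.le
          · exact inv_le_of_inv_le₀ hν (le_max_right _ _)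

theorem exists_posPart_le [NeZero N] (hp : 1 < p) (hs₁ : s₁ ∈ Ioo (0 : ℝ) 1)
    (hsp : sp ∈ Ioo (0 : ℝ) 1) (hδ : 0 < δ) :
    ∃ C > 0, ∀ {Ω : Set (Eucl N)} {u : Eucl N → ℝ} {x₀ : Eucl N} {r : ℝ},
      IsWeakSolution p s₁ sp Ω u → 0 < r → closure (Metric.ball x₀ r) ⊆ Ω →
      ∀ᵐ x ∂(volume.restrict (Metric.ball x₀ (r / 2))),
        max (u x) 0 ≤ supBound p s₁ sp C δ u x₀ r := by
  obtain ⟨C, hC, h⟩ := exists_ae_le_of_supBound_lt (N := N) hp hs₁ hsp hδ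
  refine ⟨C, hC, fun {Ω u x₀ r} hsol hr hB => ?_⟩
  have hmeas := hsol.2.2.1.1
  have hmk := hmeas.ae_eq_mk
  have hle : ∀ᵐ x ∂(volume.restrict (Metric.ball x₀ (r / 2))),
      hmeas.mk u x ≤ supBound p s₁ sp C δ u x₀ r := by
    refine eventually_le_const_iff_forall_gt_eventually_lt_const.2 fun K hK => ?_
    obtain ⟨K', hK', hK'K⟩ := exists_between hK
    rw [supBound_congr_ae hmk] at hK'
    exact (h hmeas.stronglyMeasurable_mk.measurable (hsol.congr_ae hmk) hr hB hK').mono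
      fun x hx => hx.trans_lt hK'K
  filter_upwards [hle, ae_restrict_of_ae hmk] with x hx hxmk
  rw [hxmk]
  exact max_le hx (add_nonneg (mul_nonneg hC.le (incrInv_nonneg _ _))
    (mul_nonneg hδ.le (incrInv_nonneg _ _)))

theorem isLocallyBoundedIn_of_forall_exists_nhds
    (h : ∀ x ∈ Ω, ∃ U ∈ nhds x, ∃ M : ℝ, ∀ᵐ y ∂(volume.restrict U), |u y| ≤ M) :
    IsLocallyBoundedIn Ω u := by
  intro K hK hKΩ
  refine hK.induction_on (p := fun S => ∃ M : ℝ, ∀ᵐ x ∂(volume.restrict S), |u x| ≤ M)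
    ⟨0, by simp⟩ ?_ ?_ fun x hx => ?_
  · rintro S S' hS ⟨M, hM⟩
    exact ⟨M, ae_restrict_of_ae_restrict_of_subset hS hM⟩
  · rintro S S' ⟨M, hM⟩ ⟨M', hM'⟩
    exact ⟨max M M', (ae_restrict_union_iff _ _ _).2
      ⟨hM.mono fun x hx => hx.trans (le_max_left _ _),
        hM'.mono fun x hx => hx.trans (le_max_right _ _)⟩⟩
  · obtain ⟨U, hU, hM⟩ := h x (hKΩ hx)
    exact ⟨U, mem_nhdsWithin_of_mem_nhds hU, hM⟩

theorem IsWeakSolution.isLocallyBoundedIn [NeZero N] (hp : 1 < p) (hs₁ : s₁ ∈ Ioo (0 : ℝ) 1)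
    (hsp : sp ∈ Ioo (0 : ℝ) 1) (hΩ : IsOpen Ω) (hu : IsWeakSolution p s₁ sp Ω u) :
    IsLocallyBoundedIn Ω u := by
  obtain ⟨C, -, h⟩ := exists_posPart_le (N := N) hp hs₁ hsp one_pos
  refine isLocallyBoundedIn_of_forall_exists_nhds fun x₀ hx₀ => ?_
  obtain ⟨r, hr, hrΩ⟩ := Metric.nhds_basis_closedBall.mem_iff.1 (hΩ.mem_nhds hx₀)
  have hB := Metric.closure_ball_subset_closedBall.trans hrΩ
  refine ⟨Metric.ball x₀ (r / 2), Metric.ball_mem_nhds _ (by positivity),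
    max (supBound p s₁ sp C 1 u x₀ r) (supBound p s₁ sp C 1 (fun x => -u x) x₀ r), ?_⟩
  filter_upwards [h hu hr hB, h hu.neg hr hB] with x hpos hneg
  exact abs_le'.2 ⟨(le_max_left _ _).trans (hpos.trans (le_max_left _ _)),
    (le_max_left _ _).trans (hneg.trans (le_max_right _ _))⟩

end LocalBound

theorem proposition3p3_general (N : ℕ) [NeZero N] (p s₁ sp : ℝ) (hp : 1 < p)
    (hs₁ : s₁ ∈ Set.Ioo (0 : ℝ) 1) (hsp : sp ∈ Set.Ioo (0 : ℝ) 1) :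
    (∀ Ω : Set (Eucl N), IsOpen Ω →
      ∀ u : Eucl N → ℝ, IsWeakSolution p s₁ sp Ω u → IsLocallyBoundedIn Ω u) ∧
    ∀ δ : ℝ, 0 < δ → ∃ C : ℝ, 0 < C ∧
      ∀ (Ω : Set (Eucl N)) (u : Eucl N → ℝ), IsWeakSolution p s₁ sp Ω u →
      ∀ (x₀ : Eucl N) (r : ℝ), 0 < r → closure (Metric.ball x₀ r) ⊆ Ω →
        (∀ᵐ x ∂(volume.restrict (Metric.ball x₀ (r / 2))),
          max (u x) 0 ≤
            C * incrInv (bigH p s₁ sp r)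
                (⨍ y in Metric.ball x₀ r, bigH p s₁ sp r (max (u y) 0)) +
              δ * incrInv (smallH p s₁ sp r)
                (r ^ (-(sp * p)) * (Tail p sp u x₀ (r / 2) ^ (p - 1) + 1))) ∧
        (∀ᵐ x ∂(volume.restrict (Metric.ball x₀ (r / 2))),
          max (-u x) 0 ≤
            C * incrInv (bigH p s₁ sp r)
                (⨍ y in Metric.ball x₀ r, bigH p s₁ sp r (max (-u y) 0)) +
              δ * incrInv (smallH p s₁ sp r)
                (r ^ (-(sp * p)) * (Tail p sp u x₀ (r / 2) ^ (p - 1) + 1))) := by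
  refine ⟨fun Ω hΩ u hu => hu.isLocallyBoundedIn hp hs₁ hsp hΩ, fun δ hδ => ?_⟩
  obtain ⟨C, hC, h⟩ := exists_posPart_le (N := N) hp hs₁ hsp hδ
  refine ⟨C, hC, fun Ω u hu x₀ r hr hB => ⟨h hu hr hB, ?_⟩⟩
  simpa only [supBound, Tail_neg] using h hu.neg hr hB

theorem proposition3p3 (N : ℕ) (hN : 2 ≤ N) (p s₁ sp : ℝ) (hp : 1 < p)
    (hs₁ : s₁ ∈ Set.Ioo (0 : ℝ) 1) (hsp : sp ∈ Set.Ioo (0 : ℝ) 1) :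
    (∀ Ω : Set (Eucl N), IsOpen Ω → IsConnected Ω → Bornology.IsBounded Ω →
      ∀ u : Eucl N → ℝ, IsWeakSolution p s₁ sp Ω u → IsLocallyBoundedIn Ω u) ∧
    ∀ δ : ℝ, 0 < δ → ∃ C : ℝ, 0 < C ∧
      ∀ Ω : Set (Eucl N), IsOpen Ω → IsConnected Ω → Bornology.IsBounded Ω →
      ∀ u : Eucl N → ℝ, IsWeakSolution p s₁ sp Ω u →
      ∀ (x₀ : Eucl N) (r : ℝ), 0 < r → closure (Metric.ball x₀ (2 * r)) ⊆ Ω →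
        (∀ᵐ x ∂(volume.restrict (Metric.ball x₀ (r / 2))),
          max (u x) 0 ≤
            C * incrInv (bigH p s₁ sp r)
                (⨍ y in Metric.ball x₀ r, bigH p s₁ sp r (max (u y) 0)) +
              δ * incrInv (smallH p s₁ sp r)
                (r ^ (-(sp * p)) * (Tail p sp u x₀ (r / 2) ^ (p - 1) + 1))) ∧
        (∀ᵐ x ∂(volume.restrict (Metric.ball x₀ (r / 2))),
          max (-u x) 0 ≤
            C * incrInv (bigH p s₁ sp r)
                (⨍ y in Metric.ball x₀ r, bigH p s₁ sp r (max (-u y) 0)) +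
              δ * incrInv (smallH p s₁ sp r)
                (r ^ (-(sp * p)) * (Tail p sp u x₀ (r / 2) ^ (p - 1) + 1))) := by
  have : NeZero N := ⟨by omega⟩
  obtain ⟨hbdd, hsup⟩ := proposition3p3_general N p s₁ sp hp hs₁ hsp
  refine ⟨fun Ω hΩ _ _ => hbdd Ω hΩ, fun δ hδ => ?_⟩
  obtain ⟨C, hC, h⟩ := hsup δ hδ
  exact ⟨C, hC, fun Ω _ _ _ u hu x₀ r hr hB =>
    h Ω u hu x₀ r hr ((closure_mono (Metric.ball_subset_ball (by linarith))).trans hB)⟩
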